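/- Let $(\mathfrak L^{n+1},\mathfrak g)=(\mathbb R\times M^n,\,-N^2dt^2+g)$ be a static spacetime, where $(M^n,g)$ is a smooth Riemannian manifold and $N\colon M\to\mathbb R^+$ is a smooth positive function (the lapse). Let $P^n\hookrightarrow\mathfrak L^{n+1}$ be a photon surface, i.e. a smoothly embedded timelike hypersurface which is null totally geodesic: every null geodesic initially tangent to $P$ remains in $P$ and tangent to $P$ (at least on some time interval around the initial time). Assume that $P$ is equipotential, i.e. $N$ is constant on each canonical time slice $\Sigma(t)=P\cap(\{t\}\times M)$, and non-degenerate, i.e. $dN\neq0$ at every point of $P$. No field equations are assumed. Let $\eta$ be a smooth unit normal to $P$, and let $\mathfrak H$ be the mean curvature of $P$ with respect to $\eta$, that is, the trace with respect to the induced metric of $\mathfrak h(X,Y)=\mathfrak g({}^{\mathfrak g}\nabla_X\eta,Y)$. Let $\mathcal T$ be the set of all $t$ with $\Sigma(t)\neq\emptyset$, let $u\colon\mathcal T\to\mathbb R$, $u(t)=N|_{\Sigma(t)}$, and $\dot u=\frac{du}{dt}$. Let $\nu$ be the unit normal of $\Sigma(t)$ in $(M,g)$ with $\mathfrak g(\nu,\eta)>0$,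 let $\nu(N)$ be the $\nu$-derivative of $N$, and let $Z$ be the vector field on $P$ which is tangent to $P$, orthogonal to every $\Sigma(t)$, and satisfies $dt(Z)=1$. Then $\mathcal T$ is open, $u$ is smooth and positive on $\mathcal T$, $\nu(N)\neq0$ and $\frac{\dot u^2}{u^2\nu(N)^2}<1$ on $P$, the function $\frac{\dot u}{\nu(N)}$ is smooth on $P$, and the following hold. 1. Along $P$, $$\frac{u\,\mathfrak H}{n}\,\sqrt{1-\frac{\dot u^2}{u^2\nu(N)^2}}^{\,3}=\left(1-\frac{\dot u^2}{u^2\nu(N)^2}\right)\nu(N)+\frac1u\,Z\!\left(\frac{\dot u}{\nu(N)}\right)-\frac{\dot u^2}{u^2\,\nu(N)},$$ where $u$ and $\dot u$ are evaluated at the time $t$ of the point of $P$. 2. If $(t_i)_{i\in\mathbb N}$ is a sequence in $\mathcal T$ with $\dot u(t_i)=0$ for all $i$ and $t_0\in\mathcal T$ is an accumulation point of the set $\{t_i\mid i\in\mathbb N\}$ (every neighbourhood of $t_0$ contains some $t_i\neq t_0$), then $u(t_0)\,\mathfrak H=n\,\nu(N)$ at every point of $\Sigma(t_0)$. 3. If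 $P$ is a photon sphere, i.e. $P=\mathbb R\times S_0$ for a smooth hypersurface $S_0\hookrightarrow M$ and $N$ is constant along $P$, then $N\,\mathfrak H=n\,\nu(N)$ on $P$. -/

import Mathlib

open Set Filter Topology Manifold
open scoped ContDiff Manifold

noncomputable section

section Connection

variable {E H X : Type*} [NormedAddCommGroup E] [NormedSpace ℝ E] [TopologicalSpace H]
  [TopologicalSpace X] [ChartedSpace H X]
  {F K Y : Type*} [NormedAddCommGroup F] [NormedSpace ℝ F] [TopologicalSpace K]
  [TopologicalSpace Y] [ChartedSpace K Y]

/-- A field of bilinear forms on the tangent spaces of `X`; used for (pseudo-)Riemannian metrics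
on manifolds without boundary. -/
abbrev MetricField (I : ModelWithCorners ℝ E H) (X : Type*) [TopologicalSpace X]
    [ChartedSpace H X] : Type _ :=
  ∀ x : X, TangentSpace I x →L[ℝ] TangentSpace I x →L[ℝ] ℝ

/-- The coordinate expression `G_y(a, b)` of the metric in the preferred chart around `q`, at the
coordinate point `y` and for coordinate vectors `a, b`. -/
def metricInChart {I : ModelWithCorners ℝ E H} (G : MetricField I X) (q : X) (y a b : E) : ℝ :=
  G ((extChartAt I q).symm y) (mfderiv 𝓘(ℝ, E) I (extChartAt I q).symm y a)
    (mfderiv 𝓘(ℝ, E) I (extChartAt I q).symm y b)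

/-- The Christoffel symbols of the first kind in the preferred chart around `q`:
`Γ_y(a, b; c) = (∂_a G(b, c) + ∂_b G(a, c) - ∂_c G(a, b)) / 2`. -/
def christoffelInChart {I : ModelWithCorners ℝ E H} (G : MetricField I X) (q : X)
    (y a b c : E) : ℝ :=
  (1 / 2) * (fderiv ℝ (fun z => metricInChart G q z b c) y a
    + fderiv ℝ (fun z => metricInChart G q z a c) y b
    - fderiv ℝ (fun z => metricInChart G q z a b) y c)

/-- The number `G(∇_v V, w)`, where `V` is a vector field along the map `f : Y → X`, `v` is a
tangent vector of `Y` at `y`, `w` is a tangent vector of `X` at `f y` and `∇` is the (pull-back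
along `f` of the) Levi-Civita connection of the metric `G`, computed in the preferred chart around
`q`. For `f y` in the domain of that chart the value does not depend on `q`. -/
def covDerivInChart {I : ModelWithCorners ℝ E H} {J : ModelWithCorners ℝ F K}
    (G : MetricField I X) (q : X) (f : Y → X) (V : ∀ y, TangentSpace I (f y)) (y : Y)
    (v : TangentSpace J y) (w : TangentSpace I (f y)) : ℝ :=
  metricInChart G q (extChartAt I q (f y))
      (mfderiv J 𝓘(ℝ, E) (fun y' => (mfderiv I 𝓘(ℝ, E) (extChartAt I q) (f y') (V y') : E)) y v)
      (mfderiv I 𝓘(ℝ, E) (extChartAt I q) (f y) w)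
    + christoffelInChart G q (extChartAt I q (f y))
      (mfderiv I 𝓘(ℝ, E) (extChartAt I q) (f y) (mfderiv J I f y v))
      (mfderiv I 𝓘(ℝ, E) (extChartAt I q) (f y) (V y))
      (mfderiv I 𝓘(ℝ, E) (extChartAt I q) (f y) w)

/-- The number `G(∇_v V, w)`, computed in the preferred chart at the point `f y`. -/
def covDerivAlong {I : ModelWithCorners ℝ E H} {J : ModelWithCorners ℝ F K}
    (G : MetricField I X) (f : Y → X) (V : ∀ y, TangentSpace I (f y)) (y : Y)
    (v : TangentSpace J y) (w : TangentSpace I (f y)) : ℝ :=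
  covDerivInChart G (f y) f V y v w

/-- The velocity of a curve. -/
def curveVelocity (I : ModelWithCorners ℝ E H) (γ : ℝ → X) (s : ℝ) : TangentSpace I (γ s) :=
  mfderiv 𝓘(ℝ, ℝ) I γ s (1 : ℝ)

/-- The curve `γ` is a geodesic of the (nondegenerate) metric `G` on the set `J`: it is twice
continuously differentiable there and `∇_{γ'} γ' = 0`, read off in a chart around each of its
points (the choice of the chart is immaterial). -/
def IsGeodesicOn {I : ModelWithCorners ℝ E H} (G : MetricField I X) (γ : ℝ → X)
    (J : Set ℝ) : Prop :=
  ContMDiffOn 𝓘(ℝ, ℝ) I 2 γ J ∧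
    ∀ s ∈ J, ∃ q : X, γ s ∈ (extChartAt I q).source ∧ ∀ w : TangentSpace I (γ s),
      covDerivInChart (J := 𝓘(ℝ, ℝ)) G q γ (curveVelocity I γ) s (1 : ℝ) w = 0

end Connection

section Hypersurface

variable {E H X : Type*} [NormedAddCommGroup E] [NormedSpace ℝ E] [TopologicalSpace H]
  [TopologicalSpace X] [ChartedSpace H X]
  {n : ℕ} {P : Type*} [TopologicalSpace P] [ChartedSpace (EuclideanSpace ℝ (Fin n)) P]

/-- The differential of the inclusion `ι : P → X` of a hypersurface. -/
abbrev hypDiff (I : ModelWithCorners ℝ E H) (ι : P → X) (p : P) :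
    TangentSpace (𝓡 n) p →L[ℝ] TangentSpace I (ι p) :=
  mfderiv (𝓡 n) I ι p

/-- `η` is a smooth unit (spacelike) normal field along `ι : P → X`. -/
structure IsUnitNormal {I : ModelWithCorners ℝ E H} [IsManifold I ∞ X] (G : MetricField I X)
    (ι : P → X) (η : ∀ p, TangentSpace I (ι p)) : Prop where
  smooth : ContMDiff (𝓡 n) I.tangent ∞ (fun p => (⟨ι p, η p⟩ : TangentBundle I X))
  unit : ∀ p, G (ι p) (η p) (η p) = 1
  normal : ∀ p (v : TangentSpace (𝓡 n) p), G (ι p) (η p) (hypDiff I ι p v) = 0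

/-- The second fundamental form with respect to `η`: `h(v, w) = G(∇_v η, w)`. -/
def secondFundamentalForm {I : ModelWithCorners ℝ E H} (G : MetricField I X)
    (ι : P → X) (η : ∀ p, TangentSpace I (ι p)) (p : P) (v w : TangentSpace (𝓡 n) p) : ℝ :=
  covDerivAlong G ι η p v (hypDiff I ι p w)

/-- The standard basis vectors of a tangent space of `P` (those of the preferred chart). -/
def tangentBasisVector (p : P) (i : Fin n) : TangentSpace (𝓡 n) p :=
  EuclideanSpace.single i (1 : ℝ)

/-- The mean curvature with respect to `η`: the trace `∑ p^{ij} h_{ij}` of the second fundamental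
form with respect to the induced metric `p_{ij}`. -/
def meanCurvature {I : ModelWithCorners ℝ E H} (G : MetricField I X)
    (ι : P → X) (η : ∀ p, TangentSpace I (ι p)) (p : P) : ℝ :=
  Matrix.trace
    ((Matrix.of fun i j : Fin n => G (ι p) (hypDiff I ι p (tangentBasisVector p i))
        (hypDiff I ι p (tangentBasisVector p j)))⁻¹ *
      (Matrix.of fun i j : Fin n => secondFundamentalForm G ι η p
        (tangentBasisVector p i) (tangentBasisVector p j)))

/-- `ι : P → X` is a smooth embedding of an `n`-dimensional manifold `P` which is timelike, i.e.
each tangent space of `P` contains a timelike vector (for a hyperplane of a Lorentzian vector space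
this means that the induced scalar product is Lorentzian). It is meant for
`dim X = n + 1`. -/
structure IsTimelikeHypersurface {I : ModelWithCorners ℝ E H} (G : MetricField I X)
    (ι : P → X) : Prop where
  embedding : IsSmoothEmbedding (𝓡 n) I ∞ ι
  timelike : ∀ p, ∃ v : TangentSpace (𝓡 n) p, G (ι p) (hypDiff I ι p v) (hypDiff I ι p v) < 0

/-- A photon surface: a timelike hypersurface which is null totally geodesic, i.e. every null
geodesic initially tangent to `P` remains (on some time interval around the initial time) in `P`
and tangent to `P`. As `P` may be incomplete, the geodesic may leave `P` through its edge later. -/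
structure IsPhotonSurface {I : ModelWithCorners ℝ E H} (G : MetricField I X)
    (ι : P → X) : Prop extends IsTimelikeHypersurface (n := n) G ι where
  null_totally_geodesic : ∀ (γ : ℝ → X) (J : Set ℝ), IsOpen J → J.OrdConnected → (0 : ℝ) ∈ J →
    IsGeodesicOn G γ J →
    G (γ 0) (curveVelocity I γ 0) (curveVelocity I γ 0) = 0 →
    (∃ (p : P) (v : TangentSpace (𝓡 n) p),
      (⟨γ 0, curveVelocity I γ 0⟩ : TangentBundle I X) = ⟨ι p, hypDiff I ι p v⟩) →
    ∃ ε > 0, ∀ s ∈ J, |s| < ε → ∃ (p : P) (v : TangentSpace (𝓡 n) p),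
      (⟨γ s, curveVelocity I γ s⟩ : TangentBundle I X) = ⟨ι p, hypDiff I ι p v⟩

/-- A smooth embedded hypersurface of `X` (as a subset): locally a regular zero set. -/
def IsSmoothHypersurface (I : ModelWithCorners ℝ E H) (S : Set X) : Prop :=
  ∀ x ∈ S, ∃ U : Set X, IsOpen U ∧ x ∈ U ∧ ∃ f : X → ℝ, ContMDiffOn I 𝓘(ℝ, ℝ) ∞ f U ∧
    (∀ y ∈ U, mfderiv I 𝓘(ℝ, ℝ) f y ≠ 0) ∧ S ∩ U = {y ∈ U | f y = 0}

end Hypersurface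

/-- The data of a static spacetime `(ℝ × M, -N² dt² + g)`: a smooth Riemannian metric `g` and a
smooth positive lapse function `N` on the `n`-dimensional manifold `M`. -/
structure StaticSpacetime (n : ℕ) (M : Type*) [TopologicalSpace M]
    [ChartedSpace (EuclideanSpace ℝ (Fin n)) M] [IsManifold (𝓡 n) ∞ M] where
  g : Bundle.ContMDiffRiemannianMetric (𝓡 n) ∞ (EuclideanSpace ℝ (Fin n))
    (fun x : M => TangentSpace (𝓡 n) x)
  N : M → ℝ
  smooth_N : ContMDiff (𝓡 n) 𝓘(ℝ, ℝ) ∞ N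
  N_pos : ∀ x, 0 < N x

/-- The model of `ℝ × M` for an `n`-dimensional manifold `M`. -/
abbrev spacetimeModel (n : ℕ) : ModelWithCorners ℝ (ℝ × EuclideanSpace ℝ (Fin n))
    (ModelProd ℝ (EuclideanSpace ℝ (Fin n))) :=
  𝓘(ℝ, ℝ).prod (𝓡 n)

namespace StaticSpacetime

variable {n : ℕ} {M : Type*} [TopologicalSpace M]
  [ChartedSpace (EuclideanSpace ℝ (Fin n)) M] [IsManifold (𝓡 n) ∞ M]

/-- The differential `dt` of the time coordinate on `ℝ × M`. -/
def dt (x : ℝ × M) : TangentSpace (spacetimeModel n) x →L[ℝ] ℝ :=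
  mfderiv (spacetimeModel n) 𝓘(ℝ, ℝ) (Prod.fst : ℝ × M → ℝ) x

/-- The differential of the projection `ℝ × M → M`, i.e. the spatial part of a tangent vector. -/
def spatialPart (x : ℝ × M) :
    TangentSpace (spacetimeModel n) x →L[ℝ] TangentSpace (𝓡 n) x.2 :=
  mfderiv (spacetimeModel n) (𝓡 n) (Prod.snd : ℝ × M → M) x

/-- The Lorentzian metric `-N² dt² + g` on `ℝ × M`. -/
def metric (S : StaticSpacetime n M) : MetricField (spacetimeModel n) (ℝ × M) := fun x =>
  (ContinuousLinearMap.precomp ℝ (spatialPart x)).comp ((S.g.inner x.2).comp (spatialPart x))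
    - (S.N x.2) ^ 2 • (dt x).smulRight (dt x)

lemma metric_apply (S : StaticSpacetime n M) (x : ℝ × M)
    (v w : TangentSpace (spacetimeModel n) x) :
    S.metric x v w = S.g.inner x.2 (spatialPart x v) (spatialPart x w)
      - S.N x.2 ^ 2 * (dt x v * dt x w) := by
  simp [metric]

variable {P : Type*} [TopologicalSpace P] [ChartedSpace (EuclideanSpace ℝ (Fin n)) P]

/-- The canonical time slice `Σ(t) = P ∩ {time = t}`, as a subset of `P`. -/
def timeSlice (ι : P → ℝ × M) (t : ℝ) : Set P := {p | (ι p).1 = t}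

/-- The set of all times `t` with nonempty canonical time slice `Σ(t)`. -/
def times (ι : P → ℝ × M) : Set ℝ := {t | (timeSlice ι t).Nonempty}

/-- The lapse function is constant on each canonical time slice. -/
def IsEquipotential (S : StaticSpacetime n M) (ι : P → ℝ × M) : Prop :=
  ∀ t, ∀ p ∈ timeSlice ι t, ∀ q ∈ timeSlice ι t, S.N (ι p).2 = S.N (ι q).2

/-- `dN` vanishes nowhere on `P`. -/
def IsNondegenerate (S : StaticSpacetime n M) (ι : P → ℝ × M) : Prop :=
  ∀ p, mfderiv (𝓡 n) 𝓘(ℝ, ℝ) S.N (ι p).2 ≠ 0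

open Classical in
/-- The lapse function `u(t) = N|_{Σ(t)}` along an equipotential hypersurface, for `t` in
`times ι` (and zero elsewhere). -/
def lapseAlong (S : StaticSpacetime n M) (ι : P → ℝ × M) (t : ℝ) : ℝ :=
  if h : (timeSlice ι t).Nonempty then S.N (ι h.some).2 else 0

/-- `v` is tangent to the canonical time slice through `p`. -/
def TangentToSlice (ι : P → ℝ × M) (p : P) (v : TangentSpace (𝓡 n) p) : Prop :=
  dt (ι p) (hypDiff (spacetimeModel n) ι p v) = 0

/-- `ν` is the unit normal in `(M, g)` to the canonical time slice through `p`, on the side to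
which the unit normal `η` of `P` points. -/
structure IsSliceNormal (S : StaticSpacetime n M) (ι : P → ℝ × M)
    (η : ∀ p, TangentSpace (spacetimeModel n) (ι p))
    (p : P) (ν : TangentSpace (𝓡 n) (ι p).2) : Prop where
  unit : S.g.inner (ι p).2 ν ν = 1
  normal : ∀ v : TangentSpace (𝓡 n) p, TangentToSlice ι p v →
    S.g.inner (ι p).2 ν (spatialPart (ι p) (hypDiff (spacetimeModel n) ι p v)) = 0
  side : 0 < S.g.inner (ι p).2 ν (spatialPart (ι p) (η p))

/-- The derivative `ν(N)`. -/
def normalDerivLapse (S : StaticSpacetime n M) (ι : P → ℝ × M)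
    (ν : ∀ p, TangentSpace (𝓡 n) (ι p).2) (p : P) : ℝ :=
  mfderiv (𝓡 n) 𝓘(ℝ, ℝ) S.N (ι p).2 (ν p)

/-- `Z` is the value at `p` of the vertical vector field of `P`: tangent to `P`, orthogonal to the
canonical time slice, and normalised by `dt(Z) = 1`; i.e. the velocity of the curves in `P` which
are parametrised by `t` and orthogonal to the canonical time slices. -/
structure IsVertical (S : StaticSpacetime n M) (ι : P → ℝ × M) (p : P)
    (Z : TangentSpace (𝓡 n) p) : Prop where
  time : dt (ι p) (hypDiff (spacetimeModel n) ι p Z) = 1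
  orthogonal : ∀ v : TangentSpace (𝓡 n) p, TangentToSlice ι p v →
    S.metric (ι p) (hypDiff (spacetimeModel n) ι p Z) (hypDiff (spacetimeModel n) ι p v) = 0

/-- The derivative `v(f)` of a real function on `P` in the direction `v`. -/
def dirDeriv (f : P → ℝ) (p : P) (v : TangentSpace (𝓡 n) p) : ℝ :=
  mfderiv (𝓡 n) 𝓘(ℝ, ℝ) f p v

/-- A photon sphere: a photon surface of the form `ℝ × S₀` with a smooth hypersurface `S₀` of `M`,
along which the lapse function is constant. -/
structure IsPhotonSphere (S : StaticSpacetime n M) (ι : P → ℝ × M) : Prop extends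
    IsPhotonSurface (n := n) S.metric ι where
  cylinder : ∃ S₀ : Set M, IsSmoothHypersurface (𝓡 n) S₀ ∧ range ι = univ ×ˢ S₀
  lapse_const : ∀ p q, S.N (ι p).2 = S.N (ι q).2

end StaticSpacetime

end

/-! The evolution equation is a computation of the mean curvature in one timelike direction. On a
photon surface the second fundamental form `h` vanishes on null vectors: a null geodesic starting
tangent to `P` stays in `P`, so `G(η, γ') = 0` along it, and differentiating this with `∇γ' = 0`
gives `h(γ', γ') = 0` (`IsPhotonSurface.secondFundamentalForm_null`). A quadratic form vanishing on
the null cone of a Lorentzian product is a multiple of that product (`quadratic_eq_of_null`), so `P`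
is umbilic and `H = n h(Z, Z) / G(Z, Z)` for the vertical field `Z` (`meanCurvature_eq_of_null`).

Everything is then written through the time component `b = dt(η)` and the spatial part `θ` of `η`.
Put `A = 1 + N²b²`, which is `g(θ, θ)`, and `d = dN(θ)`. Then `ν = θ/√A`, `ν(N) = d/√A`, and the
spatial part of `Z` is `kθ` with `k = N²b/A`. The chain rule for `u ∘ time = N` on `P` gives `u' = k
d`, hence `u'/ν(N) = N²b/√A` and `1 - u'²/(u²ν(N)²) = 1/A`. Moreover `G(Z, Z) = -N²/A`, and `h(Z,
Z)` follows from `secondFundamentalForm_vertical`, so that `H = n (Z(b) + (1 + N²b²/A) d/N)`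
(`meanCurvature_photonSurface`). Substituting these expressions turns the evolution equation into
the algebraic `evolution_identity`.

At a point where `u'` and `Z(u'/ν(N))` both vanish the equation reads `u H = n ν(N)`. An
accumulation point of zeros of `u'` is a zero of `u'` and of `u''`, and on a photon sphere `u' = 0`
identically; this yields the last two claims. -/

noncomputable section

/-! ### Metrics and vector fields in charts. -/

section Charts

variable {E H X : Type*} [NormedAddCommGroup E] [NormedSpace ℝ E] [TopologicalSpace H]
  [TopologicalSpace X] [ChartedSpace H X] {I : ModelWithCorners ℝ E H}
  {F K Y : Type*} [NormedAddCommGroup F] [NormedSpace ℝ F] [TopologicalSpace K]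
  [TopologicalSpace Y] [ChartedSpace K Y] {J : ModelWithCorners ℝ F K}

/-- The coordinate expression of a metric as a function with values in bilinear forms. -/
def chartMetric (G : MetricField I X) (q : X) (y : E) : E →L[ℝ] E →L[ℝ] ℝ :=
  (ContinuousLinearMap.precomp ℝ (mfderiv 𝓘(ℝ, E) I (extChartAt I q).symm y)).comp
    ((G ((extChartAt I q).symm y)).comp (mfderiv 𝓘(ℝ, E) I (extChartAt I q).symm y))

/-- The three scalar derivatives become values of one derivative of the form-valued map, which makes
trilinearity in `a`, `b`, `c` visible. -/
lemma christoffelInChart_eq {G : MetricField I X} {q : X} {y : E}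
    (hG : DifferentiableAt ℝ (chartMetric G q) y) (a b c : E) :
    christoffelInChart G q y a b c = (1 / 2) * (fderiv ℝ (chartMetric G q) y a b c
      + fderiv ℝ (chartMetric G q) y b a c - fderiv ℝ (chartMetric G q) y c a b) := by
  have key : ∀ d b c : E, fderiv ℝ (fun z => metricInChart G q z b c) y d =
      fderiv ℝ (chartMetric G q) y d b c := by
    intro d b c
    have h := (hG.hasFDerivAt.clm_apply (hasFDerivAt_const b y)).clm_apply
      (hasFDerivAt_const c y)
    refine (DFunLike.congr_fun h.fderiv d).trans ?_
    simp
  simp only [christoffelInChart, key]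

variable [IsManifold I ∞ X] [I.Boundaryless]

instance isManifold_one_of_infty : IsManifold I 1 X := IsManifold.of_le (n := ∞) (by simp)

lemma mfderiv_extChartAt_mfderiv_symm {q : X} {y : E} (hy : y ∈ (extChartAt I q).target) (a : E) :
    (mfderiv I 𝓘(ℝ, E) (extChartAt I q) ((extChartAt I q).symm y)
      (mfderiv 𝓘(ℝ, E) I (extChartAt I q).symm y a) : E) = a := by
  have h := mfderiv_extChartAt_comp_mfderivWithin_extChartAt_symm (I := I) hy
  rw [I.range_eq_univ, mfderivWithin_univ] at h
  exact congrArg (fun L => L a) h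

lemma mfderiv_symm_mfderiv_extChartAt {q x : X} (hx : x ∈ (extChartAt I q).source)
    (v : TangentSpace I x) :
    (mfderiv 𝓘(ℝ, E) I (extChartAt I q).symm (extChartAt I q x)
      (mfderiv I 𝓘(ℝ, E) (extChartAt I q) x v) : E) = v := by
  have h := mfderivWithin_extChartAt_symm_comp_mfderiv_extChartAt' (I := I) hx
  rw [I.range_eq_univ, mfderivWithin_univ] at h
  exact congrArg (fun L => L v) h

lemma chartMetric_mfderiv (G : MetricField I X) {q x : X} (hx : x ∈ (extChartAt I q).source)
    (v w : TangentSpace I x) :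
    chartMetric G q (extChartAt I q x) (mfderiv I 𝓘(ℝ, E) (extChartAt I q) x v)
      (mfderiv I 𝓘(ℝ, E) (extChartAt I q) x w) = G x v w := by
  -- The base points `φ.symm (φ x)` and `x` are only propositionally equal, so the vectors are
  -- generalised to `E` before the equality of points is substituted.
  have aux : ∀ x' : X, x' = x → ∀ v' w' : E, v' = v → w' = w → G x' v' w' = G x v w := by
    rintro x' rfl v' w' rfl rfl; rfl
  exact aux _ ((extChartAt I q).left_inv hx) _ _ (mfderiv_symm_mfderiv_extChartAt hx v)
    (mfderiv_symm_mfderiv_extChartAt hx w)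

lemma mfderiv_extChartAt_injective {q x : X} (hx : x ∈ (extChartAt I q).source) :
    Function.Injective (mfderiv I 𝓘(ℝ, E) (extChartAt I q) x) := fun v w h => by
  have := congrArg (mfderiv 𝓘(ℝ, E) I (extChartAt I q).symm (extChartAt I q x)) h
  exact (mfderiv_symm_mfderiv_extChartAt hx v).symm.trans
    (this.trans (mfderiv_symm_mfderiv_extChartAt hx w))

/-- Used to identify the initial velocity of a geodesic built in coordinates with a vector tangent
to the hypersurface. -/
lemma tangentBundle_ext_chart {q : X} {z z' : TangentBundle I X} (hz : z.1 = z'.1)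
    (hq : z.1 ∈ (extChartAt I q).source)
    (h : (mfderiv I 𝓘(ℝ, E) (extChartAt I q) z.1 z.2 : E) =
      mfderiv I 𝓘(ℝ, E) (extChartAt I q) z'.1 z'.2) : z = z' := by
  obtain ⟨x, v⟩ := z
  obtain ⟨x', v'⟩ := z'
  obtain rfl : x = x' := hz
  exact congrArg (Bundle.TotalSpace.mk x) (mfderiv_extChartAt_injective hq h)

lemma mdifferentiableAt_extChartAt_symm {q : X} {y : E} (hy : y ∈ (extChartAt I q).target) :
    MDifferentiableAt 𝓘(ℝ, E) I (extChartAt I q).symm y :=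
  (mdifferentiableOn_extChartAt_symm y hy).mdifferentiableAt
    ((isOpen_extChartAt_target q).mem_nhds hy)

/-- The coordinate expression of a smooth vector field along a map is smooth. -/
lemma contMDiffAt_coordinates {f : Y → X} {V : ∀ y, TangentSpace I (f y)} {q : X} {y : Y}
    (hV : ContMDiffAt J I.tangent ∞ (fun y => (⟨f y, V y⟩ : TangentBundle I X)) y)
    (hq : f y ∈ (extChartAt I q).source) :
    ContMDiffAt J 𝓘(ℝ, E) ∞
      (fun y' => (mfderiv I 𝓘(ℝ, E) (extChartAt I q) (f y') (V y') : E)) y := by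
  have hf : f y ∈ (chartAt H q).source := by rwa [extChartAt_source] at hq
  have h := ((trivializationAt E (TangentSpace I) q).contMDiffAt_iff (n := ∞)
    (f := fun y => (⟨f y, V y⟩ : TangentBundle I X)) (x₀ := y) (IB := I) (IM := J)
    (by rw [Bundle.Trivialization.mem_source]; simpa using hf)).1 hV
  refine h.2.congr_of_eventuallyEq ?_
  have hopen : IsOpen (chartAt H q).source := (chartAt H q).open_source
  filter_upwards [h.1.continuousAt.preimage_mem_nhds (hopen.mem_nhds hf)] with z hz
  have hz' : f z ∈ (chartAt H q).source := hz
  -- On the chart domain the trivialization of the tangent bundle is the differential of the chart.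
  have h1 := congrArg (fun T => T (V z))
    (TangentBundle.continuousLinearMapAt_trivializationAt (I := I) hz')
  exact h1.symm.trans ((trivializationAt E (TangentSpace I) q).continuousLinearMapAt_apply_of_mem
    (R := ℝ) (by simpa using hz') (V z))

/-- A smooth metric is smooth in charts. -/
lemma contDiffOn_chartMetric [FiniteDimensional ℝ E] {G : MetricField I X}
    (hG : ContMDiff I (I.prod 𝓘(ℝ, E →L[ℝ] E →L[ℝ] ℝ)) ∞
      (fun x => Bundle.TotalSpace.mk' (E →L[ℝ] E →L[ℝ] ℝ)
        (E := fun x : X => TangentSpace I x →L[ℝ] TangentSpace I x →L[ℝ] ℝ) x (G x))) (q : X) :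
    ContDiffOn ℝ ∞ (chartMetric G q) (extChartAt I q).target := by
  have hs : ContMDiffOn 𝓘(ℝ, E) I ∞ (extChartAt I q).symm (extChartAt I q).target :=
    contMDiffOn_extChartAt_symm q
  have ho : IsOpen (extChartAt I q).target := isOpen_extChartAt_target q
  have ht := hs.contMDiffOn_tangentMapWithin (m := ∞) (by simp) ho.uniqueMDiffOn
  -- The coordinate vector field of `a` is the tangent map of the inverse chart applied to a
  -- constant section, hence smooth.
  have hfield : ∀ a : E, ContMDiffOn 𝓘(ℝ, E) I.tangent ∞
      (fun y => (⟨(extChartAt I q).symm y, mfderiv 𝓘(ℝ, E) I (extChartAt I q).symm y a⟩ :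
        TangentBundle I X)) (extChartAt I q).target := by
    intro a
    have hc : ContMDiffOn 𝓘(ℝ, E) 𝓘(ℝ, E).tangent ∞
        (fun y : E => (⟨y, a⟩ : TangentBundle 𝓘(ℝ, E) E)) (extChartAt I q).target :=
      contMDiffOn_vectorSpace_iff_contDiffOn.2 contDiffOn_const
    refine (ht.comp hc (fun y hy => hy)).congr fun y hy => ?_
    simp only [Function.comp, tangentMapWithin]
    rw [mfderivWithin_of_isOpen ho hy]
  rw [contDiffOn_clm_apply]
  intro a
  rw [contDiffOn_clm_apply]
  intro b
  rw [← contMDiffOn_iff_contDiffOn]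
  intro y hy
  have := ContMDiffWithinAt.clm_bundle_apply₂ (F₁ := E) (F₂ := E) (F₃ := ℝ)
    (E₁ := fun x : X => TangentSpace I x) (E₂ := fun x : X => TangentSpace I x)
    (E₃ := Bundle.Trivial X ℝ) (IM := 𝓘(ℝ, E)) (IB := I)
    (ψ := fun y => G ((extChartAt I q).symm y))
    (hG.contMDiffAt.comp_contMDiffWithinAt y (hs y hy)) (hfield a y hy) (hfield b y hy)
  simp only [Bundle.contMDiffWithinAt_totalSpace] at this
  exact this.2

end Charts

/-! ### Injectivity of differentials of immersions, and curves with given velocity. -/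

section Immersions

variable {E H X : Type*} [NormedAddCommGroup E] [NormedSpace ℝ E] [TopologicalSpace H]
  [TopologicalSpace X] [ChartedSpace H X] {I : ModelWithCorners ℝ E H}
  {F K Y : Type*} [NormedAddCommGroup F] [NormedSpace ℝ F] [TopologicalSpace K]
  [TopologicalSpace Y] [ChartedSpace K Y] {J : ModelWithCorners ℝ F K}
  [IsManifold I ∞ X] [I.Boundaryless] [IsManifold J ∞ Y] [J.Boundaryless]

/-- The differential of an immersion is injective. -/
lemma IsImmersionAt.mfderiv_injective {f : Y → X} {y : Y} (h : IsImmersionAt J I ∞ f y) :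
    Function.Injective (mfderiv J I f y) := by
  have hf : MDifferentiableAt J I f y := h.contMDiffAt.mdifferentiableAt (by simp)
  have hc : MDifferentiableAt I 𝓘(ℝ, E) (h.codChart.extend I) (f y) :=
    (OpenPartialHomeomorph.contMDiffAt_extend h.codChart_mem_maximalAtlas
      h.mem_codChart_source).mdifferentiableAt (n := ∞) (by simp)
  have ho : IsOpen (h.domChart.extend J).target := h.domChart.isOpen_extend_target
  have hy : y ∈ (h.domChart.extend J).source := by
    rw [OpenPartialHomeomorph.extend_source]; exact h.mem_domChart_source
  have hd' : MDifferentiableAt 𝓘(ℝ, F) J (h.domChart.extend J).symm (h.domChart.extend J y) := by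
    refine ((contMDiffOn_extend_symm (n := ∞) h.domChart_mem_maximalAtlas).contMDiffAt
      ?_).mdifferentiableAt (by simp)
    rw [← OpenPartialHomeomorph.extend_target']
    exact ho.mem_nhds ((h.domChart.extend J).map_source hy)
  -- in the charts the map is `u ↦ equiv (u, 0)`
  have hev : (fun y' => (h.domChart.extend J).symm
      (((h.equiv.symm (h.codChart.extend I (f y')))).1)) =ᶠ[𝓝 y] id := by
    filter_upwards [h.domChart.open_source.mem_nhds h.mem_domChart_source] with y' hy'
    have hy'' : y' ∈ (h.domChart.extend J).source := by
      rwa [OpenPartialHomeomorph.extend_source]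
    have := h.writtenInCharts ((h.domChart.extend J).map_source hy'')
    simp only [Function.comp, (h.domChart.extend J).left_inv hy''] at this
    change (h.domChart.extend J).symm (h.equiv.symm (h.codChart.extend I (f y'))).1 = y'
    rw [this, h.equiv.symm_apply_apply]
    exact (h.domChart.extend J).left_inv hy''
  -- `T` undoes the linear normal form, so conjugating it by the charts gives a differentiable local
  -- left inverse of `f`; its differential is a left inverse of that of `f`.
  let T : E →L[ℝ] F := (ContinuousLinearMap.fst ℝ F h.complement).comp
    (h.equiv.symm : E →L[ℝ] F × h.complement)
  have hT : T (h.codChart.extend I (f y)) = h.domChart.extend J y := by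
    have := h.writtenInCharts ((h.domChart.extend J).map_source hy)
    simp only [Function.comp, (h.domChart.extend J).left_inv hy] at this
    change (h.equiv.symm (h.codChart.extend I (f y))).1 = _
    rw [this, h.equiv.symm_apply_apply]
  have hg : MDifferentiableAt I J
      (fun x => (h.domChart.extend J).symm (T (h.codChart.extend I x))) (f y) := by
    refine MDifferentiableAt.comp (f y) (I' := 𝓘(ℝ, F)) (g := (h.domChart.extend J).symm)
      (f := fun x => T (h.codChart.extend I x)) (by rw [hT]; exact hd') ?_
    exact (T.differentiableAt.mdifferentiableAt).comp (f y) (I' := 𝓘(ℝ, E)) hc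
  intro v w hvw
  have h1 := mfderiv_comp y hg hf
  have h2 := hev.mfderiv_eq (I := J) (I' := J)
  have h3 : ∀ v : F, (mfderiv J J (fun y' => (h.domChart.extend J).symm
      (((h.equiv.symm (h.codChart.extend I (f y')))).1)) y (v : TangentSpace J y) : F) = v :=
    fun v => (congrArg (fun T => T v) h2).trans (DFunLike.congr_fun (mfderiv_id (I := J) (x := y)) v)
  have h4 : ∀ v : TangentSpace J y, (mfderiv I J
      (fun x => (h.domChart.extend J).symm (T (h.codChart.extend I x))) (f y)
      (mfderiv J I f y v) : F) = v :=
    fun v => (congrArg (fun T => T v) h1).symm.trans (h3 v)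
  exact (h4 v).symm.trans ((congrArg _ hvw).trans (h4 w))

/-- A curve in a manifold with prescribed initial velocity. -/
lemma exists_curve_mfderiv_eq (y : Y) (v : F) :
    ∃ c : ℝ → Y, c 0 = y ∧ ContMDiffAt 𝓘(ℝ, ℝ) J ∞ c 0 ∧
      (mfderiv 𝓘(ℝ, ℝ) J c 0 (1 : ℝ) : F) = v := by
  have hs : ContMDiffAt 𝓘(ℝ, F) J ∞ (extChartAt J y).symm (extChartAt J y y) :=
    (contMDiffOn_extChartAt_symm y).contMDiffAt (extChartAt_target_mem_nhds y)
  have hl : ContMDiffAt 𝓘(ℝ, ℝ) 𝓘(ℝ, F) ∞ (fun s : ℝ => extChartAt J y y + s • v) 0 :=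
    (contDiff_const.add (contDiff_id.smul contDiff_const)).contDiffAt.contMDiffAt
  have hl' : HasDerivAt (fun s : ℝ => extChartAt J y y + s • v) v 0 := by
    simpa using ((hasDerivAt_id (0 : ℝ)).smul_const v).const_add (extChartAt J y y)
  have h0 : extChartAt J y y + (0 : ℝ) • v = extChartAt J y y := by simp
  refine ⟨fun s => (extChartAt J y).symm (extChartAt J y y + s • v), by simp, ?_, ?_⟩
  · exact ContMDiffAt.comp (0 : ℝ) (by rw [h0]; exact hs) hl
  · have h1 := mfderiv_comp_apply_of_eq (0 : ℝ) (g := (extChartAt J y).symm)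
      (f := fun s : ℝ => extChartAt J y y + s • v) (y := extChartAt J y y)
      (hs.mdifferentiableAt (by simp)) (hl.mdifferentiableAt (by simp)) h0 (1 : ℝ)
    have h2 : (mfderiv 𝓘(ℝ, ℝ) 𝓘(ℝ, F) (fun s : ℝ => extChartAt J y y + s • v) 0 (1 : ℝ) : F)
        = v := by
      rw [mfderiv_eq_fderiv]
      exact hl'.deriv
    have h3 := mfderivWithin_range_extChartAt_symm (I := J) (x := y)
    rw [J.range_eq_univ, mfderivWithin_univ] at h3
    refine h1.trans ?_
    exact (DFunLike.congr_fun h3 _).trans h2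

end Immersions

/-! ### Local existence for the geodesic equation. -/

section GeodesicEquation

variable {E : Type*} [NormedAddCommGroup E] [NormedSpace ℝ E]

/-- A nondegenerate bilinear form on a finite-dimensional space is invertible. -/
lemma isInvertible_of_nondegenerate [FiniteDimensional ℝ E] (B : E →L[ℝ] E →L[ℝ] ℝ)
    (hB : ∀ v, (∀ w, B v w = 0) → v = 0) : B.IsInvertible := by
  have hinj : Function.Injective (B : E →ₗ[ℝ] (E →L[ℝ] ℝ)) := by
    rw [injective_iff_map_eq_zero]
    intro v hv
    refine hB v fun w => ?_
    have := DFunLike.congr_fun hv w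
    simpa using this
  have hrank : Module.finrank ℝ E = Module.finrank ℝ (E →L[ℝ] ℝ) := by
    rw [← Subspace.dual_finrank_eq (K := ℝ) (V := E)]
    exact (LinearMap.toContinuousLinearMap (𝕜 := ℝ) (E := E) (F' := ℝ)).finrank_eq
  let e := (LinearMap.linearEquivOfInjective (B : E →ₗ[ℝ] (E →L[ℝ] ℝ)) hinj
    hrank).toContinuousLinearEquiv
  refine ⟨e, ?_⟩
  ext v w
  simp [e]

set_option maxSynthPendingDepth 5 in
/-- Local solvability of the geodesic equation of a field `B` of nondegenerate bilinear forms. -/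
lemma exists_solution_geodesic_equation [FiniteDimensional ℝ E] {U : Set E} (hU : IsOpen U)
    {B : E → E →L[ℝ] E →L[ℝ] ℝ} (hB : ContDiffOn ℝ ∞ B U)
    (hinv : ∀ y ∈ U, (B y).IsInvertible) {y₀ : E} (hy₀ : y₀ ∈ U) (a₀ : E) :
    ∃ ε > (0 : ℝ), ∃ y a a' : ℝ → E, y 0 = y₀ ∧ a 0 = a₀ ∧ ContDiffOn ℝ ∞ y (Ioo (-ε) ε) ∧
      ∀ s ∈ Ioo (-ε) ε, y s ∈ U ∧ HasDerivAt y (a s) s ∧ HasDerivAt a (a' s) s ∧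
        ∀ c, B (y s) (a' s) c + (fderiv ℝ B (y s) (a s) (a s) c
          - (1 / 2) * fderiv ℝ B (y s) c (a s) (a s)) = 0 := by
  -- `Γ (y, a)` is the Christoffel symbol at `(a, a)` for symmetric `B`, with index lowered. The
  -- second-order equation becomes the first-order system `(y, a)' = V (y, a)`.
  let Γ : E × E → E →L[ℝ] ℝ := fun z => fderiv ℝ B z.1 z.2 z.2
    - (1 / 2 : ℝ) • ((fderiv ℝ B z.1).flip z.2).flip z.2
  let V : E × E → E × E := fun z => (z.2, -((B z.1).inverse (Γ z)))
  have hDB : ContDiffOn ℝ ∞ (fderiv ℝ B) U :=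
    hB.fderiv_of_isOpen hU (by simp)
  have hfst : ContDiffOn ℝ ∞ (fun z : E × E => z.1) (U ×ˢ univ) := contDiff_fst.contDiffOn
  have hsnd : ContDiffOn ℝ ∞ (fun z : E × E => z.2) (U ×ˢ univ) := contDiff_snd.contDiffOn
  have hDB' : ContDiffOn ℝ ∞ (fun z : E × E => fderiv ℝ B z.1) (U ×ˢ univ) :=
    hDB.comp hfst fun z hz => hz.1
  have hΓ : ContDiffOn ℝ ∞ Γ (U ×ˢ univ) := by
    rw [contDiffOn_clm_apply]
    intro c
    have h1 : ContDiffOn ℝ ∞ (fun z : E × E => fderiv ℝ B z.1 z.2 z.2 c) (U ×ˢ univ) :=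
      ((hDB'.clm_apply hsnd).clm_apply hsnd).clm_apply contDiffOn_const
    have h2 : ContDiffOn ℝ ∞ (fun z : E × E => fderiv ℝ B z.1 c z.2 z.2) (U ×ˢ univ) :=
      ((hDB'.clm_apply contDiffOn_const).clm_apply hsnd).clm_apply hsnd
    exact h1.sub (contDiffOn_const.mul h2)
  have hV : ContDiffOn ℝ ∞ V (U ×ˢ univ) := by
    refine hsnd.prodMk (ContDiffOn.neg (ContDiffOn.clm_apply ?_ hΓ))
    intro z hz
    have : CompleteSpace E := FiniteDimensional.complete ℝ E
    exact ((hinv z.1 hz.1).contDiffAt_map_inverse).comp_contDiffWithinAt z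
      ((hB z.1 hz.1).comp z (hfst z hz) fun z hz => hz.1)
  have hUo : IsOpen (U ×ˢ (univ : Set E)) := hU.prod isOpen_univ
  have : CompleteSpace E := FiniteDimensional.complete ℝ E
  have hV0 : ContDiffAt ℝ 1 V (y₀, a₀) :=
    (hV.contDiffAt (hUo.mem_nhds ⟨hy₀, mem_univ _⟩)).of_le (by simp)
  obtain ⟨z, hz0, ε₁, hε₁, hz⟩ :=
    hV0.exists_forall_mem_closedBall_exists_eq_forall_mem_Ioo_hasDerivAt₀ 0
  have hcont : ContinuousAt z 0 := (hz 0 ⟨by linarith, by linarith⟩).continuousAt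
  have hmem : ∀ᶠ s in 𝓝 (0 : ℝ), z s ∈ U ×ˢ (univ : Set E) :=
    hcont.preimage_mem_nhds (by rw [hz0]; exact hUo.mem_nhds ⟨hy₀, mem_univ _⟩)
  obtain ⟨ε₂, hε₂, hmem⟩ := Metric.eventually_nhds_iff.1 hmem
  -- Halving leaves room for the closed interval `[-ε, ε]` inside both open ones, as the smoothness
  -- statement for solutions is on a closed interval.
  let ε := min ε₁ ε₂ / 2
  have hε : 0 < ε := by positivity
  have hεε₁ : ε < ε₁ := (half_lt_self (by positivity)).trans_le (min_le_left _ _)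
  have hεε₂ : ε < ε₂ := (half_lt_self (by positivity)).trans_le (min_le_right _ _)
  have hderiv : ∀ s ∈ Icc (-ε) ε, HasDerivAt z (V (z s)) s := fun s hs =>
    hz s ⟨by linarith [hs.1], by linarith [hs.2]⟩
  have hmaps : MapsTo z (Icc (-ε) ε) (U ×ˢ univ) := fun s hs => hmem (by
    rw [Real.dist_eq, sub_zero, abs_lt]; exact ⟨by linarith [hs.1], by linarith [hs.2]⟩)
  have hsmooth : ContDiffOn ℝ ∞ z (Icc (-ε) ε) := by
    refine ODE.contDiffOn_enat_Icc_of_hasDerivWithinAt (n := ⊤) (f := fun _ => V) (u := U ×ˢ univ)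
      ?_ (fun s hs => (hderiv s hs).hasDerivWithinAt) hmaps
    exact hV.comp contDiff_snd.contDiffOn fun w hw => hw.2
  refine ⟨ε, hε, fun s => (z s).1, fun s => (z s).2, fun s => (V (z s)).2, by simp [hz0],
    by simp [hz0], contDiff_fst.comp_contDiffOn (hsmooth.mono Ioo_subset_Icc_self), ?_⟩
  intro s hs
  have hs' := Ioo_subset_Icc_self hs
  have hd := hderiv s hs'
  refine ⟨(hmaps hs').1, hd.fst, hd.snd, fun c => ?_⟩
  have hB' := (hinv _ (hmaps hs').1).self_apply_inverse (Γ (z s))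
  have hB'' := DFunLike.congr_fun hB' c
  simp only [V, map_neg, neg_apply]
  rw [hB'']
  simp [Γ]

end GeodesicEquation

/-! ### Photon surfaces: the second fundamental form on null vectors. -/

section NullGeodesics

variable {E H X : Type*} [NormedAddCommGroup E] [NormedSpace ℝ E] [TopologicalSpace H]
  [TopologicalSpace X] [ChartedSpace H X] {I : ModelWithCorners ℝ E H}
  [IsManifold I ∞ X] [I.Boundaryless] {G : MetricField I X} {q : X}

lemma chartMetric_symm (hsymm : ∀ x (v w : TangentSpace I x), G x v w = G x w v) (y a b : E) :
    chartMetric G q y a b = chartMetric G q y b a := hsymm _ _ _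

lemma fderiv_chartMetric_symm (hsymm : ∀ x (v w : TangentSpace I x), G x v w = G x w v) {y : E}
    (hG : DifferentiableAt ℝ (chartMetric G q) y) (d a b : E) :
    fderiv ℝ (chartMetric G q) y d a b = fderiv ℝ (chartMetric G q) y d b a := by
  have h : ∀ a b : E, fderiv ℝ (fun z => chartMetric G q z a b) y d =
      fderiv ℝ (chartMetric G q) y d a b := by
    intro a b
    refine (DFunLike.congr_fun ((hG.hasFDerivAt.clm_apply (hasFDerivAt_const a y)).clm_apply
      (hasFDerivAt_const b y)).fderiv d).trans ?_
    simp
  rw [← h, ← h]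
  congr 2
  funext z
  exact chartMetric_symm hsymm z a b

lemma curveVelocity_symm_extChartAt {y : ℝ → E} {s : ℝ} {a : E}
    (hs : y s ∈ (extChartAt I q).target) (hy : HasDerivAt y a s) :
    (curveVelocity I (fun s => (extChartAt I q).symm (y s)) s : E) =
      mfderiv 𝓘(ℝ, E) I (extChartAt I q).symm (y s) a := by
  have h := mfderiv_comp_apply (I := 𝓘(ℝ, ℝ)) s (mdifferentiableAt_extChartAt_symm hs)
    hy.differentiableAt.mdifferentiableAt (1 : ℝ)
  have h2 : (mfderiv 𝓘(ℝ, ℝ) 𝓘(ℝ, E) y s (1 : ℝ) : E) = a := by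
    rw [mfderiv_eq_fderiv]
    exact hy.deriv
  exact h.trans (congrArg (mfderiv 𝓘(ℝ, E) I (extChartAt I q).symm (y s)) h2)

/-- The definition of a geodesic permits any chart around each point. Using the same `q` for all
times makes the coordinate velocity and acceleration literally `a` and `a'`. -/
lemma isGeodesicOn_symm_extChartAt {J : Set ℝ} (hJ : IsOpen J) {y a a' : ℝ → E}
    (hsmooth : ContDiffOn ℝ ∞ y J)
    (h : ∀ s ∈ J, y s ∈ (extChartAt I q).target ∧ HasDerivAt y (a s) s ∧ HasDerivAt a (a' s) s ∧
      ∀ c, chartMetric G q (y s) (a' s) c + christoffelInChart G q (y s) (a s) (a s) c = 0) :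
    IsGeodesicOn G (fun s => (extChartAt I q).symm (y s)) J := by
  refine ⟨?_, fun s hs => ⟨q, (extChartAt I q).map_target (h s hs).1, fun w => ?_⟩⟩
  · have h1 : ContMDiffOn 𝓘(ℝ, E) I 2 (extChartAt I q).symm (extChartAt I q).target :=
      (contMDiffOn_extChartAt_symm (n := ∞) q).of_le ENat.LEInfty.out
    have h2 : ContMDiffOn 𝓘(ℝ, ℝ) 𝓘(ℝ, E) 2 y J :=
      (hsmooth.of_le ENat.LEInfty.out).contMDiffOn
    exact h1.comp h2 fun s hs => (h s hs).1
  · obtain ⟨hys, hy, ha, heq⟩ := h s hs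
    have hvel : ∀ s ∈ J, (mfderiv I 𝓘(ℝ, E) (extChartAt I q) ((extChartAt I q).symm (y s))
        (curveVelocity I (fun s => (extChartAt I q).symm (y s)) s) : E) = a s := fun s hs =>
      (congrArg (mfderiv I 𝓘(ℝ, E) (extChartAt I q) ((extChartAt I q).symm (y s)))
        (curveVelocity_symm_extChartAt (h s hs).1 (h s hs).2.1)).trans
        (mfderiv_extChartAt_mfderiv_symm (h s hs).1 (a s))
    have hacc : (mfderiv 𝓘(ℝ, ℝ) 𝓘(ℝ, E) (fun s' => (mfderiv I 𝓘(ℝ, E) (extChartAt I q)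
        ((extChartAt I q).symm (y s'))
        (curveVelocity I (fun s => (extChartAt I q).symm (y s)) s') : E)) s (1 : ℝ) : E)
        = a' s := by
      have hev : (fun s' => (mfderiv I 𝓘(ℝ, E) (extChartAt I q)
        ((extChartAt I q).symm (y s'))
        (curveVelocity I (fun s => (extChartAt I q).symm (y s)) s') : E)) =ᶠ[𝓝 s] a := by
        filter_upwards [hJ.mem_nhds hs] with s' hs' using hvel s' hs'
      refine (DFunLike.congr_fun mfderiv_eq_fderiv (1 : ℝ)).trans ?_
      exact (DFunLike.congr_fun hev.fderiv_eq (1 : ℝ)).trans ha.deriv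
    have hpt : extChartAt I q ((extChartAt I q).symm (y s)) = y s :=
      (extChartAt I q).right_inv hys
    have aux : ∀ (y₁ y₂ A₁ A₂ a₁ a₂ a₃ c : E), y₁ = y₂ → A₁ = A₂ → a₁ = a₃ → a₂ = a₃ →
        chartMetric G q y₂ A₂ c + christoffelInChart G q y₂ a₃ a₃ c = 0 →
        metricInChart G q y₁ A₁ c + christoffelInChart G q y₁ a₁ a₂ c = 0 := by
      rintro y₁ y₂ A₁ A₂ a₁ a₂ a₃ c rfl rfl rfl rfl h
      exact h
    exact aux _ _ _ _ _ _ _ _ hpt hacc (hvel s hs) (hvel s hs) (heq _)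

variable {n : ℕ} {P : Type*} [TopologicalSpace P] [ChartedSpace (EuclideanSpace ℝ (Fin n)) P]
  [IsManifold (𝓡 n) ∞ P]

set_option maxSynthPendingDepth 5 in
/-- The second fundamental form of a photon surface vanishes on null vectors. -/
lemma IsPhotonSurface.secondFundamentalForm_null [FiniteDimensional ℝ E]
    (hsymm : ∀ x (v w : TangentSpace I x), G x v w = G x w v)
    (hnd : ∀ x (v : TangentSpace I x), (∀ w, G x v w = 0) → v = 0)
    (hG : ∀ q, ContDiffOn ℝ ∞ (chartMetric G q) (extChartAt I q).target)
    {ι : P → X} (hP : IsPhotonSurface (n := n) G ι)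
    {η : ∀ p, TangentSpace I (ι p)} (hη : IsUnitNormal (n := n) G ι η)
    (p : P) (v : TangentSpace (𝓡 n) p) (hv : G (ι p) (hypDiff I ι p v) (hypDiff I ι p v) = 0) :
    secondFundamentalForm G ι η p v v = 0 := by
  set q := ι p with hq
  set φ := extChartAt I q with hφ
  have hqs : ι p ∈ φ.source := mem_extChartAt_source q
  set a₀ : E := mfderiv I 𝓘(ℝ, E) φ (ι p) (hypDiff I ι p v) with ha₀
  have htarget : IsOpen φ.target := isOpen_extChartAt_target q
  have hinv : ∀ y ∈ φ.target, (chartMetric G q y).IsInvertible := by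
    intro y hy
    refine isInvertible_of_nondegenerate _ fun b hb => ?_
    have h0 : (mfderiv 𝓘(ℝ, E) I φ.symm y b : TangentSpace I (φ.symm y)) = 0 := by
      refine hnd _ _ fun w => ?_
      have := hb (mfderiv I 𝓘(ℝ, E) φ (φ.symm y) w)
      have h2 := mfderiv_symm_mfderiv_extChartAt (I := I) (φ.map_target hy) w
      rw [← this]
      have aux : ∀ (y₁ : E), y₁ = y → (mfderiv 𝓘(ℝ, E) I φ.symm y₁
          (mfderiv I 𝓘(ℝ, E) φ (φ.symm y) w) : E) =
          mfderiv 𝓘(ℝ, E) I φ.symm y (mfderiv I 𝓘(ℝ, E) φ (φ.symm y) w) := by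
        rintro y₁ rfl; rfl
      have h3 := (aux _ (φ.right_inv hy)).symm.trans h2
      exact congrArg (G (φ.symm y) (mfderiv 𝓘(ℝ, E) I φ.symm y b)) h3.symm
    have := mfderiv_extChartAt_mfderiv_symm (I := I) hy b
    refine this.symm.trans ?_
    exact (congrArg (mfderiv I 𝓘(ℝ, E) φ (φ.symm y)) h0).trans (map_zero _)
  obtain ⟨ε, hε, y, a, a', hy0, ha0, hsmooth, hsol⟩ := exists_solution_geodesic_equation htarget
    (hG q) hinv (φ.map_source hqs) a₀
  have hdiff : ∀ y ∈ φ.target, DifferentiableAt ℝ (chartMetric G q) y := fun y hy =>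
    ((hG q).contDiffAt (htarget.mem_nhds hy)).differentiableAt (by simp)
  have h0J : (0 : ℝ) ∈ Ioo (-ε) ε := ⟨by linarith, hε⟩
  set γ : ℝ → X := fun s => φ.symm (y s) with hγ
  have hgeo : IsGeodesicOn G γ (Ioo (-ε) ε) := by
    refine isGeodesicOn_symm_extChartAt (a := a) (a' := a') isOpen_Ioo hsmooth fun s hs => ?_
    obtain ⟨h1, h2, h3, h4⟩ := hsol s hs
    refine ⟨h1, h2, h3, fun c => ?_⟩
    rw [christoffelInChart_eq (hdiff _ h1), ← h4 c,
      fderiv_chartMetric_symm hsymm (hdiff _ h1) c]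
    ring
  have hγ0 : γ 0 = ι p := by
    simp only [hγ, hy0]
    exact φ.left_inv hqs
  have hvelφ : ∀ s ∈ Ioo (-ε) ε,
      (mfderiv I 𝓘(ℝ, E) φ (γ s) (curveVelocity I γ s) : E) = a s := fun s hs =>
    (congrArg (mfderiv I 𝓘(ℝ, E) φ (φ.symm (y s)))
      (curveVelocity_symm_extChartAt (hsol s hs).1 (hsol s hs).2.1)).trans
      (mfderiv_extChartAt_mfderiv_symm (hsol s hs).1 (a s))
  have hinit : (⟨γ 0, curveVelocity I γ 0⟩ : TangentBundle I X) = ⟨ι p, hypDiff I ι p v⟩ := by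
    refine tangentBundle_ext_chart (q := q) hγ0 (by rw [hγ0]; exact hqs) ?_
    rw [hvelφ 0 h0J, ha0]
  have hnull : G (γ 0) (curveVelocity I γ 0) (curveVelocity I γ 0) = 0 := by
    have := congrArg (fun z : TangentBundle I X => G z.1 z.2 z.2) hinit
    exact this.trans hv
  obtain ⟨ε', hε', hc⟩ := hP.null_totally_geodesic γ _ isOpen_Ioo ordConnected_Ioo h0J hgeo hnull
    ⟨p, v, hinit⟩
  -- For each time near zero `c s` is a chosen point of `P` under `γ s`; elsewhere it defaults to
  -- `p`. Nothing is known yet about its continuity.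
  have hc' : ∀ s, ∃ p', s ∈ Ioo (-ε) ε → |s| < ε' → ∃ w : TangentSpace (𝓡 n) p',
      (⟨γ s, curveVelocity I γ s⟩ : TangentBundle I X) = ⟨ι p', hypDiff I ι p' w⟩ := by
    intro s
    by_cases h : s ∈ Ioo (-ε) ε ∧ |s| < ε'
    · obtain ⟨p', w, h'⟩ := hc s h.1 h.2
      exact ⟨p', fun _ _ => ⟨w, h'⟩⟩
    · exact ⟨p, fun h1 h2 => (h ⟨h1, h2⟩).elim⟩
  choose c hc using hc'
  have hnear : ∀ᶠ s in 𝓝 (0 : ℝ), s ∈ Ioo (-ε) ε ∧ |s| < ε' := by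
    refine Filter.Eventually.and (show ∀ᶠ s in 𝓝 (0 : ℝ), s ∈ Ioo (-ε) ε from
      isOpen_Ioo.mem_nhds h0J) ?_
    exact (continuous_abs.continuousAt (x := (0 : ℝ))).eventually_lt continuousAt_const (by simpa)
  have hιc : (ι ∘ c) =ᶠ[𝓝 0] γ := by
    filter_upwards [hnear] with s hs
    obtain ⟨w, hw⟩ := hc s hs.1 hs.2
    exact (congrArg (fun z : TangentBundle I X => z.1) hw).symm
  have hc0 : c 0 = p := hP.embedding.isEmbedding.injective (hιc.self_of_nhds.trans hγ0)
  have hγsmooth : ContMDiffAt 𝓘(ℝ, ℝ) I ∞ γ 0 := by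
    have h1 : ContMDiffAt 𝓘(ℝ, E) I ∞ φ.symm (y 0) :=
      (contMDiffOn_extChartAt_symm q).contMDiffAt (htarget.mem_nhds (hsol 0 h0J).1)
    exact h1.comp (0 : ℝ) (hsmooth.contDiffAt (isOpen_Ioo.mem_nhds h0J)).contMDiffAt
  -- Since `ι ∘ c` agrees with the smooth `γ` near zero, `c` is continuous because `ι` is an
  -- embedding, and then smooth because `ι` is an immersion.
  have hcsmooth : ContMDiffAt 𝓘(ℝ, ℝ) (𝓡 n) ∞ c 0 := by
    rw [ContMDiffAt.iff_comp_isImmersionAt (hP.embedding.isImmersion.isImmersionAt (c 0))]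
    refine ⟨?_, hγsmooth.congr_of_eventuallyEq hιc⟩
    rw [hP.embedding.isEmbedding.isInducing.continuousAt_iff]
    exact hγsmooth.continuousAt.congr hιc.symm
  have hιd : MDifferentiableAt (𝓡 n) I ι p := hP.embedding.contMDiff.mdifferentiable (by simp) p
  have hcd : MDifferentiableAt 𝓘(ℝ, ℝ) (𝓡 n) c 0 := hcsmooth.mdifferentiableAt (by simp)
  set c' : EuclideanSpace ℝ (Fin n) := mfderiv 𝓘(ℝ, ℝ) (𝓡 n) c 0 (1 : ℝ) with hc'def
  have hc'v : c' = v := by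
    refine IsImmersionAt.mfderiv_injective (hP.embedding.isImmersion.isImmersionAt p) ?_
    have h1 := mfderiv_comp_apply_of_eq (I := 𝓘(ℝ, ℝ)) 0 hιd hcd hc0 (1 : ℝ)
    have h2 : (mfderiv 𝓘(ℝ, ℝ) I (ι ∘ c) 0 (1 : ℝ) : E) = curveVelocity I γ 0 :=
      DFunLike.congr_fun hιc.mfderiv_eq (1 : ℝ)
    have h3 : (curveVelocity I γ 0 : E) = hypDiff I ι p v :=
      congrArg (fun z : TangentBundle I X => (z.2 : E)) hinit
    exact h1.symm.trans (h2.trans h3)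
  -- differentiate `G(η, γ') = 0`
  set η' : P → E := fun p' => mfderiv I 𝓘(ℝ, E) φ (ι p') (η p') with hη'
  have hη'd : MDifferentiableAt (𝓡 n) 𝓘(ℝ, E) η' p :=
    (contMDiffAt_coordinates (hη.smooth p) hqs).mdifferentiableAt (by simp)
  have he : HasDerivAt (fun s => η' (c s)) (mfderiv (𝓡 n) 𝓘(ℝ, E) η' p v : E) 0 := by
    have h1 := mfderiv_comp_apply_of_eq (I := 𝓘(ℝ, ℝ)) 0 hη'd hcd hc0 (1 : ℝ)
    have h2 : MDifferentiableAt 𝓘(ℝ, ℝ) 𝓘(ℝ, E) (η' ∘ c) 0 := hη'd.comp_of_eq (0 : ℝ) hcd hc0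
    have h3 := h2.differentiableAt.hasDerivAt
    rw [mfderiv_eq_fderiv] at h1
    have h4 : deriv (η' ∘ c) 0 = (mfderiv (𝓡 n) 𝓘(ℝ, E) η' p v : E) :=
      h1.trans (congrArg (mfderiv (𝓡 n) 𝓘(ℝ, E) η' p) hc'v)
    rw [h4] at h3
    exact h3
  obtain ⟨hy0t, hyd, had, heq⟩ := hsol 0 h0J
  have hGy : HasDerivAt (fun s => chartMetric G q (y s))
      (fderiv ℝ (chartMetric G q) (y 0) (a 0)) 0 :=
    (hdiff _ hy0t).hasFDerivAt.comp_hasDerivAt 0 hyd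
  have hprod := (hGy.clm_apply he).clm_apply had
  have hzero : (fun s => chartMetric G q (y s) (η' (c s)) (a s)) =ᶠ[𝓝 0] fun _ => 0 := by
    filter_upwards [hnear] with s hs
    obtain ⟨w, hw⟩ := hc s hs.1 hs.2
    have hyt := (hsol s hs.1).1
    have h1 : γ s = ι (c s) := congrArg (fun z : TangentBundle I X => z.1) hw
    have h2 : (mfderiv I 𝓘(ℝ, E) φ (γ s) (curveVelocity I γ s) : E) =
        mfderiv I 𝓘(ℝ, E) φ (ι (c s)) (hypDiff I ι (c s) w) :=
      congrArg (fun z : TangentBundle I X => (mfderiv I 𝓘(ℝ, E) φ z.1 z.2 : E)) hw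
    have h3 : y s = φ (ι (c s)) := by
      rw [← h1]; exact (φ.right_inv hyt).symm
    have h4 : ι (c s) ∈ φ.source := by
      rw [← h1]; exact φ.map_target hyt
    rw [← hvelφ s hs.1, h2, h3]
    exact (chartMetric_mfderiv G h4 (η (c s)) (hypDiff I ι (c s) w)).trans
      (hη.normal (c s) w)
  have hfin := hprod.unique (((hasDerivAt_const (0 : ℝ) (0 : ℝ)).congr_of_eventuallyEq hzero))
  have hDφ : DifferentiableAt ℝ (chartMetric G q) (φ (ι p)) := hdiff _ (φ.map_source hqs)
  -- Testing the geodesic equation against `η` eliminates the acceleration from the differentiated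
  -- relation. The remaining metric derivative is `(1/2) ∂_η G(a₀, a₀)`, which is the Christoffel
  -- symbol at `(a₀, η; a₀)`.
  have heq' := heq (η' p)
  simp only [hy0, ha0, hc0] at hfin heq'
  have key : chartMetric G q (φ (ι p)) (mfderiv (𝓡 n) 𝓘(ℝ, E) η' p v) a₀
      + christoffelInChart G q (φ (ι p)) a₀ (η' p) a₀ = 0 := by
    rw [christoffelInChart_eq hDφ, fderiv_chartMetric_symm hsymm hDφ a₀ a₀ (η' p)]
    rw [chartMetric_symm hsymm] at heq'
    rw [fderiv_chartMetric_symm hsymm hDφ a₀ a₀ (η' p)] at heq'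
    simp only [add_apply] at hfin
    linarith
  exact key

end NullGeodesics

/-! ### Forms vanishing on the null cone, and their traces. -/

section LinearAlgebra

/-- A bilinear form `h` that vanishes on the null vectors of a Lorentzian scalar product `b` is a
multiple of `b` as a quadratic form. -/
lemma quadratic_eq_of_null {V : Type*} [AddCommGroup V] [Module ℝ V] (b h : V →ₗ[ℝ] V →ₗ[ℝ] ℝ)
    (hsymm : ∀ v w, b v w = b w v) {z : V} (hz : b z z < 0)
    (hpos : ∀ v, b z v = 0 → v ≠ 0 → 0 < b v v) (hnull : ∀ v, b v v = 0 → h v v = 0) (v : V) :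
    h v v = h z z / b z z * b v v := by
  have hzne := hz.ne
  have horth : ∀ w, b z w = 0 → h w w = h z z / b z z * b w w ∧ h z w + h w z = 0 := by
    intro w hw
    by_cases hw0 : w = 0
    · simp [hw0]
    have hww := hpos w hw hw0
    have hr : 0 < -b z z / b w w := by
      have : 0 < -b z z := by linarith
      positivity
    -- With this scaling `z + r w` and `z - r w` are both null. The sum of the two equations
    -- determines `h w w`, the difference kills the mixed terms.
    set r := √(-b z z / b w w) with hrdef
    have hr0 : 0 < r := Real.sqrt_pos.2 hr
    have hr2 : r * r * b w w = -b z z := by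
      rw [hrdef, Real.mul_self_sqrt hr.le]
      field_simp
    have h1 := hnull (z + r • w) (by
      simp only [map_add, map_smul, LinearMap.add_apply, LinearMap.smul_apply, smul_eq_mul,
        hsymm w z, hw]
      linarith)
    have h2 := hnull (z - r • w) (by
      simp only [map_sub, map_smul, LinearMap.sub_apply, LinearMap.smul_apply, smul_eq_mul,
        hsymm w z, hw]
      linarith)
    simp only [map_add, map_sub, map_smul, LinearMap.add_apply, LinearMap.sub_apply,
      LinearMap.smul_apply, smul_eq_mul] at h1 h2
    constructor
    · have h3 : r * r * h w w = -h z z := by linarith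
      have h4 : r * r * h w w = r * r * (h z z / b z z * b w w) := by
        have : r * r * (h z z / b z z * b w w) = h z z / b z z * (r * r * b w w) := by ring
        rw [h3, this, hr2]
        rw [mul_neg, div_mul_cancel₀ _ hzne]
      exact mul_left_cancel₀ (by positivity) h4
    · have : r * (h z w + h w z) = 0 := by linarith
      exact (mul_eq_zero.1 this).resolve_left hr0.ne'
  set α := b z v / b z z with hα
  set w := v - α • z with hw
  have hzw : b z w = 0 := by
    simp only [hw, hα, map_sub, map_smul, smul_eq_mul]
    field_simp
    ring
  obtain ⟨h1, h2⟩ := horth w hzw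
  have hv : v = α • z + w := by simp [hw]
  have hbv : b v v = α * α * b z z + b w w := by
    rw [hv]
    simp only [map_add, map_smul, LinearMap.add_apply, LinearMap.smul_apply, smul_eq_mul,
      hsymm w z, hzw]
    ring
  have hhv : h v v = α * α * h z z + α * (h z w + h w z) + h w w := by
    rw [hv]
    simp only [map_add, map_smul, LinearMap.add_apply, LinearMap.smul_apply, smul_eq_mul]
    ring
  rw [hbv, hhv, h2, h1]
  field_simp
  ring

/-- The trace of a bilinear form which, as a quadratic form, is a multiple of a nondegenerate
symmetric one. -/
lemma trace_inv_mul_of_quadratic_eq {n : ℕ}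
    (b h : EuclideanSpace ℝ (Fin n) →ₗ[ℝ] EuclideanSpace ℝ (Fin n) →ₗ[ℝ] ℝ)
    (hsymm : ∀ v w, b v w = b w v) (hnd : ∀ v, (∀ w, b w v = 0) → v = 0) {c : ℝ}
    (hc : ∀ v, h v v = c * b v v) :
    Matrix.trace
      ((Matrix.of fun i j : Fin n => b (EuclideanSpace.single i 1) (EuclideanSpace.single j 1))⁻¹ *
        (Matrix.of fun i j : Fin n => h (EuclideanSpace.single i 1) (EuclideanSpace.single j 1)))
      = n * c := by
  set e : Fin n → EuclideanSpace ℝ (Fin n) := fun i => EuclideanSpace.single i 1 with he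
  set A : Matrix (Fin n) (Fin n) ℝ := Matrix.of fun i j => b (e i) (e j) with hA
  set B : Matrix (Fin n) (Fin n) ℝ := Matrix.of fun i j => h (e i) (e j) with hB
  change Matrix.trace (A⁻¹ * B) = n * c
  -- As `h` is not assumed symmetric, polarisation controls only its symmetric part; this is enough,
  -- since the trace against the symmetric `A⁻¹` does not see the rest.
  have hpol : B + B.transpose = (2 * c) • A := by
    ext i j
    have h1 := hc (e i + e j)
    simp only [map_add, LinearMap.add_apply, hc (e i), hc (e j), hsymm (e j) (e i)] at h1
    simp only [hA, hB, Matrix.add_apply, Matrix.transpose_apply, Matrix.of_apply,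
      Matrix.smul_apply, smul_eq_mul]
    linarith
  have hdet : A.det ≠ 0 := by
    intro h0
    obtain ⟨x, hx, hAx⟩ := Matrix.exists_mulVec_eq_zero_iff.2 h0
    have hsum : ∀ y : EuclideanSpace ℝ (Fin n), y = ∑ i, y i • e i := by
      intro y
      ext j
      simp [he, Finset.sum_apply, Pi.single_apply]
    have hx0 : (WithLp.toLp 2 x : EuclideanSpace ℝ (Fin n)) = 0 := by
      refine hnd _ fun w => ?_
      rw [hsum w, map_sum, LinearMap.sum_apply]
      refine Finset.sum_eq_zero fun i _ => ?_
      have h2 := congrFun hAx i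
      simp only [Matrix.mulVec, dotProduct, hA, Matrix.of_apply, Pi.zero_apply] at h2
      rw [hsum (WithLp.toLp 2 x)]
      simp only [map_smul, LinearMap.smul_apply, map_sum, smul_eq_mul]
      calc ∑ j, x j * (w i * b (e i) (e j)) = w i * ∑ j, b (e i) (e j) * x j := by
            rw [Finset.mul_sum]
            exact Finset.sum_congr rfl fun j _ => by ring
        _ = 0 := by rw [h2, mul_zero]
    apply hx
    have := congrArg (WithLp.ofLp (p := 2)) hx0
    simpa using this
  have hAT : A.transpose = A := by
    ext i j
    simp [hA, hsymm (e j) (e i)]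
  have hT : Matrix.trace (A⁻¹ * B.transpose) = Matrix.trace (A⁻¹ * B) := by
    rw [← Matrix.trace_transpose, Matrix.transpose_mul, Matrix.transpose_transpose,
      Matrix.transpose_nonsing_inv, hAT, Matrix.trace_mul_comm]
  have hsum : Matrix.trace (A⁻¹ * (B + B.transpose)) = 2 * Matrix.trace (A⁻¹ * B) := by
    rw [Matrix.mul_add, Matrix.trace_add, hT]
    ring
  rw [hpol, Matrix.mul_smul, Matrix.nonsing_inv_mul A (Ne.isUnit hdet), Matrix.trace_smul,
    Matrix.trace_one, Fintype.card_fin, smul_eq_mul] at hsum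
  linarith

end LinearAlgebra

/-! ### Mean curvature of umbilic Lorentzian hypersurfaces. -/

section MeanCurvature

variable {E H X : Type*} [NormedAddCommGroup E] [NormedSpace ℝ E] [TopologicalSpace H]
  [TopologicalSpace X] [ChartedSpace H X] {I : ModelWithCorners ℝ E H}
  [IsManifold I ∞ X] [I.Boundaryless] {G : MetricField I X}
  {n : ℕ} {P : Type*} [TopologicalSpace P] [ChartedSpace (EuclideanSpace ℝ (Fin n)) P]

/-- The second fundamental form as a bilinear form. -/
lemma exists_bilinear_secondFundamentalForm (ι : P → X) (η : ∀ p, TangentSpace I (ι p)) (p : P)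
    (hG : DifferentiableAt ℝ (chartMetric G (ι p)) (extChartAt I (ι p) (ι p))) :
    ∃ h : EuclideanSpace ℝ (Fin n) →ₗ[ℝ] EuclideanSpace ℝ (Fin n) →ₗ[ℝ] ℝ,
      ∀ v w, h v w = secondFundamentalForm G ι η p v w := by
  let L : EuclideanSpace ℝ (Fin n) →L[ℝ] E :=
    (mfderiv I 𝓘(ℝ, E) (extChartAt I (ι p)) (ι p)).comp (hypDiff I ι p)
  let e : E := mfderiv I 𝓘(ℝ, E) (extChartAt I (ι p)) (ι p) (η p)
  let T : EuclideanSpace ℝ (Fin n) →L[ℝ] E :=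
    mfderiv (𝓡 n) 𝓘(ℝ, E) (fun p' => (mfderiv I 𝓘(ℝ, E) (extChartAt I (ι p)) (ι p') (η p') : E)) p
  let y := extChartAt I (ι p) (ι p)
  let f : EuclideanSpace ℝ (Fin n) → EuclideanSpace ℝ (Fin n) → ℝ := fun v w =>
    chartMetric G (ι p) y (T v) (L w) + (1 / 2) * (fderiv ℝ (chartMetric G (ι p)) y (L v) e (L w)
      + fderiv ℝ (chartMetric G (ι p)) y e (L v) (L w)
      - fderiv ℝ (chartMetric G (ι p)) y (L w) (L v) e)
  have hf : ∀ v w, f v w = secondFundamentalForm G ι η p v w := fun v w =>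
    congrArg (chartMetric G (ι p) y (T v) (L w) + ·) (christoffelInChart_eq hG (L v) e (L w)).symm
  refine ⟨LinearMap.mk₂ ℝ f ?_ ?_ ?_ ?_, fun v w => hf v w⟩
  · intro v v' w
    simp only [f, map_add, add_apply]
    ring
  · intro c v w
    simp only [f, map_smul, smul_apply, smul_eq_mul]
    ring
  · intro v w w'
    simp only [f, map_add, add_apply]
    ring
  · intro c v w
    simp only [f, map_smul, smul_apply, smul_eq_mul]
    ring

/-- The mean curvature of a Lorentzian hypersurface whose second fundamental form vanishes on null
vectors, in terms of an arbitrary timelike vector. -/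
lemma meanCurvature_eq_of_null (hsymm : ∀ x (v w : TangentSpace I x), G x v w = G x w v)
    (ι : P → X) (η : ∀ p, TangentSpace I (ι p)) (p : P)
    (hG : DifferentiableAt ℝ (chartMetric G (ι p)) (extChartAt I (ι p) (ι p)))
    (hnull : ∀ v : TangentSpace (𝓡 n) p, G (ι p) (hypDiff I ι p v) (hypDiff I ι p v) = 0 →
      secondFundamentalForm G ι η p v v = 0)
    {z : TangentSpace (𝓡 n) p} (hz : G (ι p) (hypDiff I ι p z) (hypDiff I ι p z) < 0)
    (hpos : ∀ v : TangentSpace (𝓡 n) p, G (ι p) (hypDiff I ι p z) (hypDiff I ι p v) = 0 →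
      v ≠ 0 → 0 < G (ι p) (hypDiff I ι p v) (hypDiff I ι p v)) :
    meanCurvature (n := n) G ι η p = n * (secondFundamentalForm G ι η p z z /
      G (ι p) (hypDiff I ι p z) (hypDiff I ι p z)) := by
  obtain ⟨h, hh⟩ := exists_bilinear_secondFundamentalForm (G := G) (n := n) ι η p hG
  let L : EuclideanSpace ℝ (Fin n) →L[ℝ] TangentSpace I (ι p) := hypDiff I ι p
  let b : EuclideanSpace ℝ (Fin n) →ₗ[ℝ] EuclideanSpace ℝ (Fin n) →ₗ[ℝ] ℝ :=
    LinearMap.mk₂ ℝ (fun v w => G (ι p) (L v) (L w)) (by intros; simp) (by intros; simp)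
      (by intros; simp) (by intros; simp)
  have hb : ∀ v w, b v w = G (ι p) (L v) (L w) := fun v w => rfl
  have hbs : ∀ v w, b v w = b w v := fun v w => hsymm _ _ _
  have hq := quadratic_eq_of_null b h hbs (z := z) hz hpos
    (fun v hv => (hh v v).trans (hnull v hv))
  have hnd : ∀ v, (∀ w, b w v = 0) → v = 0 := by
    intro v hv
    by_contra hne
    exact absurd (hv v) (hpos v (hv z) hne).ne'
  have := trace_inv_mul_of_quadratic_eq b h hbs hnd hq
  simp only [hh] at this
  exact this.trans (congrArg (fun r => (n : ℝ) * (r / _)) (hh z z))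

end MeanCurvature

/-! ### The static metric and its coordinate expression. -/

namespace StaticSpacetime

variable {n : ℕ} {M : Type*} [TopologicalSpace M]
  [ChartedSpace (EuclideanSpace ℝ (Fin n)) M] [IsManifold (𝓡 n) ∞ M]

lemma dt_apply (x : ℝ × M) (v : TangentSpace (spacetimeModel n) x) :
    dt x v = (v : ℝ × EuclideanSpace ℝ (Fin n)).1 :=
  DFunLike.congr_fun (mfderiv_fst (I := 𝓘(ℝ, ℝ)) (I' := 𝓡 n) (x := x)) v

lemma spatialPart_apply (x : ℝ × M) (v : TangentSpace (spacetimeModel n) x) :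
    (spatialPart x v : EuclideanSpace ℝ (Fin n)) = (v : ℝ × EuclideanSpace ℝ (Fin n)).2 :=
  DFunLike.congr_fun (mfderiv_snd (I := 𝓘(ℝ, ℝ)) (I' := 𝓡 n) (x := x)) v

lemma ext_dt_spatialPart {x : ℝ × M} {v w : TangentSpace (spacetimeModel n) x}
    (h1 : dt x v = dt x w) (h2 : spatialPart x v = spatialPart x w) : v = w := by
  rw [dt_apply, dt_apply] at h1
  have h3 := (spatialPart_apply x v).symm.trans (h2.trans (spatialPart_apply x w))
  exact Prod.ext h1 h3

/-- A tangent vector with given components. -/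
lemma exists_dt_spatialPart (x : ℝ × M) (r : ℝ) (X : TangentSpace (𝓡 n) x.2) :
    ∃ v : TangentSpace (spacetimeModel n) x, dt x v = r ∧ spatialPart x v = X :=
  ⟨((r, X) : ℝ × EuclideanSpace ℝ (Fin n)), dt_apply _ _, spatialPart_apply _ _⟩

variable (S : StaticSpacetime n M)

lemma metric_symm (x : ℝ × M) (v w : TangentSpace (spacetimeModel n) x) :
    S.metric x v w = S.metric x w v := by
  rw [metric_apply, metric_apply, S.g.symm, mul_comm (dt x v)]

lemma inner_self_eq_zero {x : M} {v : TangentSpace (𝓡 n) x} (h : S.g.inner x v v = 0) : v = 0 := by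
  by_contra hne
  exact (S.g.pos x v hne).ne' h

lemma inner_self_nonneg {x : M} (v : TangentSpace (𝓡 n) x) : 0 ≤ S.g.inner x v v := by
  by_cases h : v = 0
  · simp [h]
  · exact (S.g.pos x v h).le

lemma metric_nondegenerate (x : ℝ × M) (v : TangentSpace (spacetimeModel n) x)
    (h : ∀ w, S.metric x v w = 0) : v = 0 := by
  -- Reversing the time component of `v` makes `G(v, w)` a sum of two nonnegative terms.
  obtain ⟨w, hw1, hw2⟩ := exists_dt_spatialPart (n := n) x (-dt x v) (spatialPart x v)
  have h1 := h w
  rw [metric_apply, hw1, hw2] at h1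
  have hN := S.N_pos x.2
  have h2 := S.inner_self_nonneg (spatialPart x v)
  have h3 : 0 ≤ S.N x.2 ^ 2 * (dt x v * dt x v) :=
    mul_nonneg (sq_nonneg _) (mul_self_nonneg _)
  have h4 : S.N x.2 ^ 2 * (dt x v * dt x v) = 0 := by linarith
  refine ext_dt_spatialPart ?_ ?_
  · rw [map_zero]
    simpa [hN.ne'] using h4
  · rw [map_zero]
    exact S.inner_self_eq_zero (by linarith)

lemma mem_extChartAt_target_iff {q : ℝ × M} {y : ℝ × EuclideanSpace ℝ (Fin n)} :
    y ∈ (extChartAt (spacetimeModel n) q).target ↔ y.2 ∈ (extChartAt (𝓡 n) q.2).target := by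
  rw [extChartAt_prod]
  exact ⟨fun h => h.2, fun h => ⟨by simp only [mfld_simps]; exact mem_univ y.1, h⟩⟩

/-- The spacetime metric in coordinates. -/
lemma chartMetric_metric {q : ℝ × M} {y : ℝ × EuclideanSpace ℝ (Fin n)}
    (hy : y.2 ∈ (extChartAt (𝓡 n) q.2).target) (a b : ℝ × EuclideanSpace ℝ (Fin n)) :
    chartMetric S.metric q y a b = chartMetric (I := 𝓡 n) S.g.inner q.2 y.2 a.2 b.2
      - S.N ((extChartAt (𝓡 n) q.2).symm y.2) ^ 2 * (a.1 * b.1) := by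
  have h1 : HasMFDerivAt 𝓘(ℝ, ℝ × EuclideanSpace ℝ (Fin n)) 𝓘(ℝ, ℝ)
      (fun y : ℝ × EuclideanSpace ℝ (Fin n) => y.1) y
      (ContinuousLinearMap.fst ℝ ℝ (EuclideanSpace ℝ (Fin n))) :=
    (ContinuousLinearMap.fst ℝ ℝ (EuclideanSpace ℝ (Fin n))).hasFDerivAt.hasMFDerivAt
  have h2 : HasMFDerivAt 𝓘(ℝ, ℝ × EuclideanSpace ℝ (Fin n)) 𝓘(ℝ, EuclideanSpace ℝ (Fin n))
      (fun y : ℝ × EuclideanSpace ℝ (Fin n) => y.2) y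
      (ContinuousLinearMap.snd ℝ ℝ (EuclideanSpace ℝ (Fin n))) :=
    (ContinuousLinearMap.snd ℝ ℝ (EuclideanSpace ℝ (Fin n))).hasFDerivAt.hasMFDerivAt
  have h3 := (mdifferentiableAt_extChartAt_symm (I := 𝓡 n) hy).hasMFDerivAt
  have h4 : HasMFDerivAt 𝓘(ℝ, ℝ × EuclideanSpace ℝ (Fin n)) (spacetimeModel n)
      (extChartAt (spacetimeModel n) q).symm y _ := h1.prodMk (h3.comp y h2)
  have h5 : ∀ a, (mfderiv 𝓘(ℝ, ℝ × EuclideanSpace ℝ (Fin n)) (spacetimeModel n)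
      (extChartAt (spacetimeModel n) q).symm y a : ℝ × EuclideanSpace ℝ (Fin n)) =
      (a.1, mfderiv 𝓘(ℝ, EuclideanSpace ℝ (Fin n)) (𝓡 n) (extChartAt (𝓡 n) q.2).symm y.2 a.2) :=
    fun a => DFunLike.congr_fun h4.mfderiv a
  have h6 : chartMetric S.metric q y a b = S.metric ((extChartAt (spacetimeModel n) q).symm y)
      (a.1, mfderiv 𝓘(ℝ, EuclideanSpace ℝ (Fin n)) (𝓡 n) (extChartAt (𝓡 n) q.2).symm y.2 a.2)
      (b.1, mfderiv 𝓘(ℝ, EuclideanSpace ℝ (Fin n)) (𝓡 n) (extChartAt (𝓡 n) q.2).symm y.2 b.2) :=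
    congrArg₂ (fun v w : ℝ × EuclideanSpace ℝ (Fin n) =>
      S.metric ((extChartAt (spacetimeModel n) q).symm y) v w) (h5 a) (h5 b)
  refine h6.trans ((S.metric_apply _ _ _).trans ?_)
  refine congrArg₂ (fun r s : ℝ => r - s) ?_ (congrArg₂ (fun r s : ℝ =>
    S.N ((extChartAt (𝓡 n) q.2).symm y.2) ^ 2 * (r * s)) (dt_apply _ _) (dt_apply _ _))
  exact congrArg₂ (fun v w : EuclideanSpace ℝ (Fin n) =>
      S.g.inner ((extChartAt (𝓡 n) q.2).symm y.2) v w)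
      (spatialPart_apply _ _) (spatialPart_apply _ _)

/-- The spacetime metric is smooth in charts. -/
lemma contDiffOn_chartMetric_metric (q : ℝ × M) :
    ContDiffOn ℝ ∞ (chartMetric S.metric q) (extChartAt (spacetimeModel n) q).target := by
  have hg := contDiffOn_chartMetric (I := 𝓡 n) S.g.contMDiff q.2
  have hN : ContDiffOn ℝ ∞ (fun z => S.N ((extChartAt (𝓡 n) q.2).symm z))
      (extChartAt (𝓡 n) q.2).target := by
    rw [← contMDiffOn_iff_contDiffOn]
    exact S.smooth_N.comp_contMDiffOn (contMDiffOn_extChartAt_symm q.2)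
  have hsnd : ContDiffOn ℝ ∞ (fun y : ℝ × EuclideanSpace ℝ (Fin n) => y.2)
      (extChartAt (spacetimeModel n) q).target := contDiff_snd.contDiffOn
  have hmaps : MapsTo (fun y : ℝ × EuclideanSpace ℝ (Fin n) => y.2)
      (extChartAt (spacetimeModel n) q).target (extChartAt (𝓡 n) q.2).target := fun y hy =>
    mem_extChartAt_target_iff.1 hy
  rw [contDiffOn_clm_apply]
  intro a
  rw [contDiffOn_clm_apply]
  intro b
  have h1 := ((hg.comp hsnd hmaps).clm_apply (contDiffOn_const (c := a.2))).clm_apply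
    (contDiffOn_const (c := b.2))
  have h2 := ((hN.comp hsnd hmaps).pow 2).mul (contDiffOn_const (c := a.1 * b.1))
  exact (h1.sub h2).congr fun y hy => S.chartMetric_metric (hmaps hy) a b

end StaticSpacetime

/-! ### The time function, the lapse along `P`, and the slice normal. -/

namespace StaticSpacetime

variable {n : ℕ} {M : Type*} [TopologicalSpace M]
  [ChartedSpace (EuclideanSpace ℝ (Fin n)) M] [IsManifold (𝓡 n) ∞ M]
  {P : Type*} [TopologicalSpace P] [ChartedSpace (EuclideanSpace ℝ (Fin n)) P]
  [IsManifold (𝓡 n) ∞ P]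
  {S : StaticSpacetime n M} {ι : P → ℝ × M}

lemma IsEquipotential.lapseAlong_time (h : S.IsEquipotential ι) (p : P) :
    S.lapseAlong ι (ι p).1 = S.N (ι p).2 := by
  have hne : (timeSlice ι (ι p).1).Nonempty := ⟨p, rfl⟩
  rw [lapseAlong, dif_pos hne]
  exact h _ _ hne.some_mem _ rfl

/-- The time function of a timelike hypersurface has no critical points. -/
lemma exists_dt_ne_zero (hP : IsTimelikeHypersurface (n := n) S.metric ι) (p : P) :
    ∃ v : TangentSpace (𝓡 n) p, dt (ι p) (hypDiff (spacetimeModel n) ι p v) ≠ 0 := by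
  obtain ⟨v, hv⟩ := hP.timelike p
  refine ⟨v, fun h => ?_⟩
  rw [metric_apply, h] at hv
  have := S.inner_self_nonneg (spatialPart (ι p) (hypDiff (spacetimeModel n) ι p v))
  linarith

lemma mfderiv_time {p : P} (hι : MDifferentiableAt (𝓡 n) (spacetimeModel n) ι p)
    (v : TangentSpace (𝓡 n) p) :
    (mfderiv (𝓡 n) 𝓘(ℝ, ℝ) (fun p => (ι p).1) p v : ℝ) =
      dt (ι p) (hypDiff (spacetimeModel n) ι p v) :=
  mfderiv_comp_apply p (g := (Prod.fst : ℝ × M → ℝ)) mdifferentiableAt_fst hι v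

lemma mfderiv_lapse {p : P} (hι : MDifferentiableAt (𝓡 n) (spacetimeModel n) ι p)
    (v : TangentSpace (𝓡 n) p) :
    (mfderiv (𝓡 n) 𝓘(ℝ, ℝ) (fun p => S.N (ι p).2) p v : ℝ) =
      mfderiv (𝓡 n) 𝓘(ℝ, ℝ) S.N (ι p).2
        (spatialPart (ι p) (hypDiff (spacetimeModel n) ι p v)) := by
  have hN : MDifferentiableAt (𝓡 n) 𝓘(ℝ, ℝ) S.N (ι p).2 :=
    S.smooth_N.mdifferentiable (by simp) _
  have h1 := mfderiv_comp_apply p (g := S.N) (f := fun p => (ι p).2) hN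
    (mdifferentiableAt_snd.comp p hι) v
  have h2 := mfderiv_comp_apply p (g := (Prod.snd : ℝ × M → M)) mdifferentiableAt_snd hι v
  exact h1.trans (congrArg (mfderiv (𝓡 n) 𝓘(ℝ, ℝ) S.N (ι p).2) h2)

/-- Smooth local sections of the time function of a timelike hypersurface. -/
lemma exists_time_section (hP : IsTimelikeHypersurface (n := n) S.metric ι) (p : P) :
    ∃ σ : ℝ → P, ContMDiffAt 𝓘(ℝ, ℝ) (𝓡 n) ∞ σ (ι p).1 ∧
      ∀ᶠ t in 𝓝 (ι p).1, (ι (σ t)).1 = t := by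
  obtain ⟨v, hv⟩ := exists_dt_ne_zero hP p
  obtain ⟨c, hc0, hc, hcv⟩ := exists_curve_mfderiv_eq (J := 𝓡 n) p v
  have hι : ContMDiff (𝓡 n) (spacetimeModel n) ∞ ι := hP.embedding.contMDiff
  have htime : ContMDiff (𝓡 n) 𝓘(ℝ, ℝ) ∞ (fun p => (ι p).1) := contMDiff_fst.comp hι
  set τ : ℝ → ℝ := fun s => (ι (c s)).1 with hτ
  have hτs : ContDiffAt ℝ ∞ τ 0 := (htime.contMDiffAt.comp (0 : ℝ) hc).contDiffAt
  have hτd : HasDerivAt τ (dt (ι p) (hypDiff (spacetimeModel n) ι p v)) 0 := by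
    have h1 := (hτs.differentiableAt (by simp)).hasDerivAt
    have h2 := mfderiv_comp_apply_of_eq (I := 𝓘(ℝ, ℝ)) 0 (htime.mdifferentiable (by simp) p)
      (hc.mdifferentiableAt (by simp)) hc0 (1 : ℝ)
    rw [mfderiv_eq_fderiv] at h2
    have h3 : deriv τ 0 = dt (ι p) (hypDiff (spacetimeModel n) ι p v) :=
      h2.trans ((congrArg (mfderiv (𝓡 n) 𝓘(ℝ, ℝ) (fun p => (ι p).1) p) hcv).trans
        (mfderiv_time (hι.mdifferentiable (by simp) p) v))
    rwa [h3] at h1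
  have hτ0 : τ 0 = (ι p).1 := by simp [hτ, hc0]
  have hf' := hτd.hasFDerivAt_equiv hv
  -- The time function has nonzero derivative along `c`, so the inverse function theorem
  -- reparametrises `c` by time.
  let r := hτs.localInverse hf' (by simp)
  have hr : ContDiffAt ℝ ∞ r (ι p).1 := hτ0 ▸ hτs.to_localInverse hf' (by simp)
  have hr0 : r (ι p).1 = 0 := hτ0 ▸ hτs.localInverse_apply_image hf' (by simp)
  refine ⟨fun t => c (r t), ?_, ?_⟩
  · exact ContMDiffAt.comp (ι p).1 (by rw [hr0]; exact hc) hr.contMDiffAt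
  · have := (hτs.hasStrictFDerivAt' hf' (by simp)).eventually_right_inverse
    rw [hτ0] at this
    exact this

lemma isOpen_times (hP : IsTimelikeHypersurface (n := n) S.metric ι) : IsOpen (times ι) := by
  rw [isOpen_iff_mem_nhds]
  rintro t ⟨p, rfl⟩
  obtain ⟨σ, -, hσ⟩ := exists_time_section hP p
  filter_upwards [hσ] with t ht using ⟨σ t, ht⟩

/-- Near `t` the function is `N ∘ ι ∘ σ` for a smooth local section `σ` of time: equipotentiality
makes the choice of the point in each slice irrelevant. -/
lemma contDiffAt_lapseAlong (hP : IsTimelikeHypersurface (n := n) S.metric ι)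
    (hequi : S.IsEquipotential ι) {t : ℝ} (ht : t ∈ times ι) :
    ContDiffAt ℝ ∞ (S.lapseAlong ι) t := by
  obtain ⟨p, rfl⟩ := ht
  obtain ⟨σ, hσs, hσ⟩ := exists_time_section hP p
  have hι : ContMDiff (𝓡 n) (spacetimeModel n) ∞ ι := hP.embedding.contMDiff
  have h1 : ContMDiff (𝓡 n) 𝓘(ℝ, ℝ) ∞ (fun p => S.N (ι p).2) :=
    S.smooth_N.comp (contMDiff_snd.comp hι)
  refine (h1.contMDiffAt.comp (ι p).1 hσs).contDiffAt.congr_of_eventuallyEq ?_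
  filter_upwards [hσ] with t ht
  have := hequi.lapseAlong_time (σ t)
  rwa [ht] at this

/-- This is the chain rule for `u ∘ time = N` on `P`. It shows that `dN` kills slice directions and
equals `u'` on the vertical field. -/
lemma mfderiv_lapse_eq_deriv (hP : IsTimelikeHypersurface (n := n) S.metric ι)
    (hequi : S.IsEquipotential ι) (p : P) (v : TangentSpace (𝓡 n) p) :
    (mfderiv (𝓡 n) 𝓘(ℝ, ℝ) S.N (ι p).2
        (spatialPart (ι p) (hypDiff (spacetimeModel n) ι p v)) : ℝ) =
      deriv (S.lapseAlong ι) (ι p).1 * dt (ι p) (hypDiff (spacetimeModel n) ι p v) := by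
  have hι : MDifferentiableAt (𝓡 n) (spacetimeModel n) ι p :=
    hP.embedding.contMDiff.mdifferentiable (by simp) p
  have hu : DifferentiableAt ℝ (S.lapseAlong ι) (ι p).1 :=
    (contDiffAt_lapseAlong hP hequi ⟨p, rfl⟩).differentiableAt (by simp)
  have htime : MDifferentiableAt (𝓡 n) 𝓘(ℝ, ℝ) (fun p => (ι p).1) p :=
    mdifferentiableAt_fst.comp p hι
  have h1 := mfderiv_comp_apply p (g := S.lapseAlong ι) hu.mdifferentiableAt htime v
  have h2 : S.lapseAlong ι ∘ (fun p => (ι p).1) = fun p => S.N (ι p).2 :=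
    funext hequi.lapseAlong_time
  rw [h2, mfderiv_eq_fderiv] at h1
  rw [← mfderiv_lapse hι]
  refine h1.trans ?_
  have aux : ∀ x y : ℝ, x = y → fderiv ℝ (S.lapseAlong ι) (ι p).1 x =
      deriv (S.lapseAlong ι) (ι p).1 * y := by
    rintro x _ rfl
    exact (fderiv_eq_smul_deriv _).trans (mul_comm _ _)
  exact aux _ _ (mfderiv_time hι v)

/-- The tangent spaces of a hypersurface are the orthogonal complements of the unit normal. -/
lemma exists_hypDiff_eq (hP : IsTimelikeHypersurface (n := n) S.metric ι)
    {η : ∀ p, TangentSpace (spacetimeModel n) (ι p)} (hη : IsUnitNormal (n := n) S.metric ι η)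
    (p : P) (V : TangentSpace (spacetimeModel n) (ι p)) (hV : S.metric (ι p) (η p) V = 0) :
    ∃ v : TangentSpace (𝓡 n) p, hypDiff (spacetimeModel n) ι p v = V := by
  let L' : EuclideanSpace ℝ (Fin n) →L[ℝ] ℝ × EuclideanSpace ℝ (Fin n) :=
    hypDiff (spacetimeModel n) ι p
  let ℓ' : ℝ × EuclideanSpace ℝ (Fin n) →L[ℝ] ℝ := S.metric (ι p) (η p)
  let L := L'.toLinearMap
  let ℓ := ℓ'.toLinearMap
  have hL : Function.Injective L :=
    IsImmersionAt.mfderiv_injective (hP.embedding.isImmersion.isImmersionAt p)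
  have hle : LinearMap.range L ≤ LinearMap.ker ℓ := by
    rintro _ ⟨v, rfl⟩
    exact hη.normal p v
  have h1 : Module.finrank ℝ (LinearMap.range L) = n := by
    rw [LinearMap.finrank_range_of_inj hL]
    simp
  have h2 : LinearMap.range ℓ = ⊤ := by
    rw [LinearMap.range_eq_top]
    refine LinearMap.surjective fun h => ?_
    have h3 : ℓ (η p) = 1 := hη.unit p
    rw [h] at h3
    exact zero_ne_one h3
  have h3 := ℓ.finrank_range_add_finrank_ker
  rw [h2, finrank_top] at h3
  simp only [Module.finrank_self, Module.finrank_prod, finrank_euclideanSpace,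
    Fintype.card_fin] at h3
  -- The range of the injective differential and the kernel of `G(η, ·)` both have dimension `n`.
  have h4 := Submodule.eq_of_le_of_finrank_eq hle (by omega)
  have h5 : (V : ℝ × EuclideanSpace ℝ (Fin n)) ∈ LinearMap.ker ℓ := hV
  rw [← h4] at h5
  exact h5

/-- Spatial vectors orthogonal to the spatial part of the unit normal are tangent to the canonical
time slice. -/
lemma exists_tangentToSlice (hP : IsTimelikeHypersurface (n := n) S.metric ι)
    {η : ∀ p, TangentSpace (spacetimeModel n) (ι p)} (hη : IsUnitNormal (n := n) S.metric ι η)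
    (p : P) (X : TangentSpace (𝓡 n) (ι p).2)
    (hX : S.g.inner (ι p).2 (spatialPart (ι p) (η p)) X = 0) :
    ∃ v : TangentSpace (𝓡 n) p, TangentToSlice ι p v ∧
      spatialPart (ι p) (hypDiff (spacetimeModel n) ι p v) = X := by
  obtain ⟨V, hV1, hV2⟩ := exists_dt_spatialPart (n := n) (ι p) 0 X
  obtain ⟨v, hv⟩ := exists_hypDiff_eq hP hη p V (by rw [metric_apply, hV1, hV2, hX]; simp)
  exact ⟨v, by rw [TangentToSlice, hv, hV1], by rw [hv, hV2]⟩

variable {η : ∀ p, TangentSpace (spacetimeModel n) (ι p)}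

lemma inner_spatialPart_normal (hη : IsUnitNormal (n := n) S.metric ι η) (p : P) :
    S.g.inner (ι p).2 (spatialPart (ι p) (η p)) (spatialPart (ι p) (η p)) =
      1 + S.N (ι p).2 ^ 2 * dt (ι p) (η p) ^ 2 := by
  have := hη.unit p
  rw [metric_apply] at this
  linarith

/-- A vector that is orthogonal to everything orthogonal to `θ` is a multiple of `θ`. -/
lemma eq_smul_of_forall_orthogonal {x : M} {θ Y : TangentSpace (𝓡 n) x} {A : ℝ}
    (hA : S.g.inner x θ θ = A) (hA0 : A ≠ 0)
    (h : ∀ X, S.g.inner x θ X = 0 → S.g.inner x Y X = 0) :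
    Y = (S.g.inner x θ Y / A) • θ := by
  set k := S.g.inner x θ Y / A with hk
  have h1 : S.g.inner x θ (Y - k • θ) = 0 := by
    rw [map_sub, map_smul, hA, smul_eq_mul, hk, div_mul_cancel₀ _ hA0, sub_self]
  have h2 := h _ h1
  have h3 : S.g.inner x (Y - k • θ) (Y - k • θ) = 0 := by
    rw [map_sub (S.g.inner x), sub_apply, map_smul, smul_apply, h1, h2]
    simp
  exact sub_eq_zero.1 (S.inner_self_eq_zero h3)

/-- Every spatial vector orthogonal to the spatial part `θ` of `η` is tangent to the slice, so `ν`
is parallel to `θ`; the unit length and the side condition fix the factor. -/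
lemma sliceNormal_eq (hP : IsTimelikeHypersurface (n := n) S.metric ι)
    (hη : IsUnitNormal (n := n) S.metric ι η) {p : P} {ν : TangentSpace (𝓡 n) (ι p).2}
    (hν : S.IsSliceNormal ι η p ν) :
    ν = (√(1 + S.N (ι p).2 ^ 2 * dt (ι p) (η p) ^ 2))⁻¹ • spatialPart (ι p) (η p) := by
  set θ := spatialPart (ι p) (η p) with hθ
  have hA := inner_spatialPart_normal hη p
  rw [← hθ] at hA
  set A := 1 + S.N (ι p).2 ^ 2 * dt (ι p) (η p) ^ 2 with hAdef
  have hA0 : 0 < A := by positivity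
  have h1 := S.eq_smul_of_forall_orthogonal (Y := ν) hA hA0.ne' (fun X hX => by
    obtain ⟨v, hv, rfl⟩ := exists_tangentToSlice hP hη p X hX
    exact hν.normal v hv)
  set k := S.g.inner (ι p).2 θ ν / A with hk
  have hk0 : 0 < k := div_pos (by rw [S.g.symm]; exact hν.side) hA0
  have h2 := hν.unit
  rw [h1, map_smul, map_smul, smul_apply, hA, smul_eq_mul, smul_eq_mul] at h2
  have h3 : k = (√A)⁻¹ := by
    have h4 : A = k⁻¹ ^ 2 := by
      field_simp
      linarith
    rw [h4, Real.sqrt_sq (inv_nonneg.2 hk0.le), inv_inv]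
  rw [← h3]
  exact h1

end StaticSpacetime

/-! ### The vertical field and the lapse in terms of the unit normal. -/

namespace StaticSpacetime

variable {n : ℕ} {M : Type*} [TopologicalSpace M]
  [ChartedSpace (EuclideanSpace ℝ (Fin n)) M] [IsManifold (𝓡 n) ∞ M]
  {P : Type*} [TopologicalSpace P] [ChartedSpace (EuclideanSpace ℝ (Fin n)) P]
  [IsManifold (𝓡 n) ∞ P]
  {S : StaticSpacetime n M} {ι : P → ℝ × M}
  {η : ∀ p, TangentSpace (spacetimeModel n) (ι p)}

/-- The differential of the lapse function. -/
def lapseDifferential (S : StaticSpacetime n M) (x : M) : TangentSpace (𝓡 n) x →L[ℝ] ℝ :=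
  mfderiv (𝓡 n) 𝓘(ℝ, ℝ) S.N x

/-- Orthogonality to the slice makes the spatial part a multiple of that of `η`, and `G(η, Z) = 0`
with `dt(Z) = 1` gives the factor. -/
lemma spatialPart_vertical (hP : IsTimelikeHypersurface (n := n) S.metric ι)
    (hη : IsUnitNormal (n := n) S.metric ι η) {p : P} {Z : TangentSpace (𝓡 n) p}
    (hZ : S.IsVertical ι p Z) :
    spatialPart (ι p) (hypDiff (spacetimeModel n) ι p Z) =
      (S.N (ι p).2 ^ 2 * dt (ι p) (η p) / (1 + S.N (ι p).2 ^ 2 * dt (ι p) (η p) ^ 2)) •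
        spatialPart (ι p) (η p) := by
  have hA0 : 1 + S.N (ι p).2 ^ 2 * dt (ι p) (η p) ^ 2 ≠ 0 := by positivity
  have h1 := S.eq_smul_of_forall_orthogonal
    (Y := spatialPart (ι p) (hypDiff (spacetimeModel n) ι p Z))
    (inner_spatialPart_normal hη p) hA0 (fun X hX => by
      obtain ⟨v, hv, rfl⟩ := exists_tangentToSlice hP hη p X hX
      have := hZ.orthogonal v hv
      rw [metric_apply, show dt (ι p) (hypDiff (spacetimeModel n) ι p v) = 0 from hv] at this
      linarith)
  have h2 := hη.normal p Z
  rw [metric_apply, hZ.time] at h2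
  have h3 : S.g.inner (ι p).2 (spatialPart (ι p) (η p))
      (spatialPart (ι p) (hypDiff (spacetimeModel n) ι p Z)) =
      S.N (ι p).2 ^ 2 * dt (ι p) (η p) := by linarith
  rw [h3] at h1
  exact h1

lemma normalDerivLapse_eq (hP : IsTimelikeHypersurface (n := n) S.metric ι)
    (hη : IsUnitNormal (n := n) S.metric ι η) {ν : ∀ p, TangentSpace (𝓡 n) (ι p).2}
    (hν : ∀ p, S.IsSliceNormal ι η p (ν p)) (p : P) :
    S.normalDerivLapse ι ν p = (√(1 + S.N (ι p).2 ^ 2 * dt (ι p) (η p) ^ 2))⁻¹ *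
      S.lapseDifferential (ι p).2 (spatialPart (ι p) (η p)) := by
  rw [← smul_eq_mul, ← map_smul, ← sliceNormal_eq hP hη (hν p)]
  rfl

/-- The spatial part of `η` and the slice directions span the tangent space of `M`. Since `dN`
vanishes on the slice, vanishing on the former too would give `dN = 0`. -/
lemma mfderiv_lapse_normal_ne_zero (hP : IsTimelikeHypersurface (n := n) S.metric ι)
    (hequi : S.IsEquipotential ι) (hnondeg : S.IsNondegenerate ι)
    (hη : IsUnitNormal (n := n) S.metric ι η) (p : P) :
    S.lapseDifferential (ι p).2 (spatialPart (ι p) (η p)) ≠ 0 := by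
  intro h0
  apply hnondeg p
  ext X
  have hA0 : 1 + S.N (ι p).2 ^ 2 * dt (ι p) (η p) ^ 2 ≠ 0 := by positivity
  have hA := inner_spatialPart_normal hη p
  set θ := spatialPart (ι p) (η p)
  set k := S.g.inner (ι p).2 θ X / (1 + S.N (ι p).2 ^ 2 * dt (ι p) (η p) ^ 2) with hk
  have h1 : S.g.inner (ι p).2 θ (X - k • θ) = 0 := by
    rw [map_sub, map_smul, hA, smul_eq_mul, hk, div_mul_cancel₀ _ hA0, sub_self]
  obtain ⟨v, hv, hvX⟩ := exists_tangentToSlice hP hη p _ h1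
  have h2 : S.lapseDifferential (ι p).2 _ = _ := mfderiv_lapse_eq_deriv hP hequi p v
  rw [hvX, show dt (ι p) (hypDiff (spacetimeModel n) ι p v) = 0 from hv, mul_zero, map_sub,
    map_smul, h0, smul_zero, sub_zero] at h2
  exact h2

lemma deriv_lapseAlong_eq (hP : IsTimelikeHypersurface (n := n) S.metric ι)
    (hequi : S.IsEquipotential ι) (hη : IsUnitNormal (n := n) S.metric ι η) {p : P}
    {Z : TangentSpace (𝓡 n) p} (hZ : S.IsVertical ι p Z) :
    deriv (S.lapseAlong ι) (ι p).1 =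
      S.N (ι p).2 ^ 2 * dt (ι p) (η p) / (1 + S.N (ι p).2 ^ 2 * dt (ι p) (η p) ^ 2) *
        S.lapseDifferential (ι p).2 (spatialPart (ι p) (η p)) := by
  have h := mfderiv_lapse_eq_deriv hP hequi p Z
  rw [hZ.time, mul_one, spatialPart_vertical hP hη hZ] at h
  exact h.symm.trans (map_smul (S.lapseDifferential (ι p).2) _ _)

lemma contMDiff_dt_normal (hη : IsUnitNormal (n := n) S.metric ι η) :
    ContMDiff (𝓡 n) 𝓘(ℝ, ℝ) ∞ (fun p => dt (ι p) (η p)) := by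
  have h1 : ContMDiff (spacetimeModel n) 𝓘(ℝ, ℝ) ∞ (Prod.fst : ℝ × M → ℝ) := contMDiff_fst
  have h2 := (h1.contMDiff_tangentMap (m := ∞) (by simp)).comp hη.smooth
  exact (contMDiff_snd_tangentBundle_modelSpace ℝ 𝓘(ℝ, ℝ)).comp h2

lemma contMDiff_lapse (hι : ContMDiff (𝓡 n) (spacetimeModel n) ∞ ι) :
    ContMDiff (𝓡 n) 𝓘(ℝ, ℝ) ∞ (fun p => S.N (ι p).2) :=
  S.smooth_N.comp (contMDiff_snd.comp hι)

/-- The derivative of a function on `P` as the derivative along a curve. -/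
lemma hasDerivAt_comp_curve {E' : Type*} [NormedAddCommGroup E'] [NormedSpace ℝ E']
    {f : P → E'} {p : P} (hf : MDifferentiableAt (𝓡 n) 𝓘(ℝ, E') f p) {c : ℝ → P} (hc0 : c 0 = p)
    (hc : MDifferentiableAt 𝓘(ℝ, ℝ) (𝓡 n) c 0) {v : EuclideanSpace ℝ (Fin n)}
    (hcv : (mfderiv 𝓘(ℝ, ℝ) (𝓡 n) c 0 (1 : ℝ) : EuclideanSpace ℝ (Fin n)) = v) :
    HasDerivAt (fun s => f (c s)) (mfderiv (𝓡 n) 𝓘(ℝ, E') f p v : E') 0 := by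
  have h1 := mfderiv_comp_apply_of_eq (I := 𝓘(ℝ, ℝ)) 0 hf hc hc0 (1 : ℝ)
  have h3 := (hf.comp_of_eq (0 : ℝ) hc hc0).differentiableAt.hasDerivAt
  rw [mfderiv_eq_fderiv] at h1
  have h4 : deriv (f ∘ c) 0 = (mfderiv (𝓡 n) 𝓘(ℝ, E') f p v : E') :=
    h1.trans (congrArg (mfderiv (𝓡 n) 𝓘(ℝ, E') f p) hcv)
  rw [h4] at h3
  exact h3

lemma fst_mfderiv_extChartAt {q x : ℝ × M} (hx : x ∈ (extChartAt (spacetimeModel n) q).source)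
    (v : TangentSpace (spacetimeModel n) x) :
    (mfderiv (spacetimeModel n) 𝓘(ℝ, ℝ × EuclideanSpace ℝ (Fin n))
      (extChartAt (spacetimeModel n) q) x v : ℝ × EuclideanSpace ℝ (Fin n)).1 = dt x v := by
  have hx' : MDifferentiableAt (spacetimeModel n) 𝓘(ℝ, ℝ × EuclideanSpace ℝ (Fin n))
      (extChartAt (spacetimeModel n) q) x := by
    refine mdifferentiableAt_extChartAt ?_
    rwa [extChartAt_source] at hx
  let T := ContinuousLinearMap.fst ℝ ℝ (EuclideanSpace ℝ (Fin n))
  have h1 := mfderiv_comp_apply x (g := T)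
    (f := extChartAt (spacetimeModel n) q) T.differentiableAt.mdifferentiableAt hx' v
  have h2 : T ∘ (extChartAt (spacetimeModel n) q) = (Prod.fst : ℝ × M → ℝ) := rfl
  rw [h2, mfderiv_eq_fderiv, T.fderiv] at h1
  exact h1.symm

/-- The derivative of the spacetime metric in coordinates. -/
lemma fderiv_chartMetric_metric (S : StaticSpacetime n M) {q : ℝ × M}
    {y : ℝ × EuclideanSpace ℝ (Fin n)}
    (hy : y.2 ∈ (extChartAt (𝓡 n) q.2).target) (c a b : ℝ × EuclideanSpace ℝ (Fin n)) :
    fderiv ℝ (chartMetric S.metric q) y c a b =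
      fderiv ℝ (chartMetric (I := 𝓡 n) S.g.inner q.2) y.2 c.2 a.2 b.2
      - 2 * S.N ((extChartAt (𝓡 n) q.2).symm y.2) *
        fderiv ℝ (fun z => S.N ((extChartAt (𝓡 n) q.2).symm z)) y.2 c.2 * (a.1 * b.1) := by
  have ho : IsOpen (extChartAt (𝓡 n) q.2).target := isOpen_extChartAt_target q.2
  have hG : DifferentiableAt ℝ (chartMetric S.metric q) y :=
    ((S.contDiffOn_chartMetric_metric q).contDiffAt ((isOpen_extChartAt_target q).mem_nhds
      (mem_extChartAt_target_iff.2 hy))).differentiableAt (by simp)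
  have hg : DifferentiableAt ℝ (chartMetric (I := 𝓡 n) S.g.inner q.2) y.2 :=
    ((contDiffOn_chartMetric (I := 𝓡 n) S.g.contMDiff q.2).contDiffAt
      (ho.mem_nhds hy)).differentiableAt (by simp)
  have hN : DifferentiableAt ℝ (fun z => S.N ((extChartAt (𝓡 n) q.2).symm z)) y.2 :=
    ((S.smooth_N.comp_contMDiffOn (contMDiffOn_extChartAt_symm q.2)).contMDiffAt
      (ho.mem_nhds hy)).contDiffAt.differentiableAt (by simp)
  have h1 := ((hG.hasFDerivAt.clm_apply (hasFDerivAt_const a y)).clm_apply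
      (hasFDerivAt_const b y))
  have hs : HasFDerivAt (fun y : ℝ × EuclideanSpace ℝ (Fin n) => y.2)
    (ContinuousLinearMap.snd ℝ ℝ (EuclideanSpace ℝ (Fin n))) y := hasFDerivAt_snd
  have h2 := (((hg.hasFDerivAt.clm_apply (hasFDerivAt_const a.2 y.2)).clm_apply
      (hasFDerivAt_const b.2 y.2)).comp y hs).sub
      (((hN.hasFDerivAt.comp y hs).pow 2).mul_const (a.1 * b.1))
  have hev : (fun y => chartMetric S.metric q y a b) =ᶠ[𝓝 y] fun y =>
      chartMetric (I := 𝓡 n) S.g.inner q.2 y.2 a.2 b.2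
      - S.N ((extChartAt (𝓡 n) q.2).symm y.2) ^ 2 * (a.1 * b.1) := by
    filter_upwards [continuous_snd.continuousAt.preimage_mem_nhds (ho.mem_nhds hy)] with z hz
      using S.chartMetric_metric hz a b
  have h3 := DFunLike.congr_fun (h1.unique (h2.congr_of_eventuallyEq hev)) c
  refine Eq.trans (by simp) (h3.trans ?_)
  simp
  ring

end StaticSpacetime

/-! ### The second fundamental form on the vertical field. -/

namespace StaticSpacetime

variable {n : ℕ} {M : Type*} [TopologicalSpace M]
  [ChartedSpace (EuclideanSpace ℝ (Fin n)) M] [IsManifold (𝓡 n) ∞ M]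
  {P : Type*} [TopologicalSpace P] [ChartedSpace (EuclideanSpace ℝ (Fin n)) P]
  [IsManifold (𝓡 n) ∞ P]
  {S : StaticSpacetime n M} {ι : P → ℝ × M}
  {η : ∀ p, TangentSpace (spacetimeModel n) (ι p)}

lemma fderiv_lapse_chart (S : StaticSpacetime n M) (x : M) (v : TangentSpace (𝓡 n) x) :
    (fderiv ℝ (fun z => S.N ((extChartAt (𝓡 n) x).symm z)) (extChartAt (𝓡 n) x x) v : ℝ) =
      S.lapseDifferential x v := by
  have h1 := mfderiv_comp_apply_of_eq (extChartAt (𝓡 n) x x) (g := S.N)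
    (f := (extChartAt (𝓡 n) x).symm) (y := x) (S.smooth_N.mdifferentiable (by simp) x)
    (mdifferentiableAt_extChartAt_symm (mem_extChartAt_target x)) (extChartAt_to_inv x) v
  rw [mfderiv_eq_fderiv] at h1
  have h3 := mfderivWithin_range_extChartAt_symm (I := 𝓡 n) (x := x)
  rw [ModelWithCorners.range_eq_univ, mfderivWithin_univ] at h3
  exact h1.trans (congrArg (mfderiv (𝓡 n) 𝓘(ℝ, ℝ) S.N x) (DFunLike.congr_fun h3 v))

set_option maxSynthPendingDepth 5 in
/-- The second fundamental form in the direction of the vertical vector field. -/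
lemma secondFundamentalForm_vertical (hP : IsTimelikeHypersurface (n := n) S.metric ι)
    (hη : IsUnitNormal (n := n) S.metric ι η) {p : P} {Z : TangentSpace (𝓡 n) p} {k : ℝ}
    (hZt : dt (ι p) (hypDiff (spacetimeModel n) ι p Z) = 1)
    (hZk : spatialPart (ι p) (hypDiff (spacetimeModel n) ι p Z) =
      k • spatialPart (ι p) (η p)) :
    secondFundamentalForm S.metric ι η p Z Z = (1 - k * dt (ι p) (η p)) *
      (-S.N (ι p).2 ^ 2 * dirDeriv (fun p => dt (ι p) (η p)) p Z
        - S.N (ι p).2 * (1 + k * dt (ι p) (η p)) *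
          S.lapseDifferential (ι p).2 (spatialPart (ι p) (η p))) := by
  set q := ι p with hq
  set φ := extChartAt (spacetimeModel n) q with hφ
  have hqs : ι p ∈ φ.source := mem_extChartAt_source q
  have htarget : IsOpen φ.target := isOpen_extChartAt_target q
  set y : ℝ × EuclideanSpace ℝ (Fin n) := φ (ι p) with hy
  have hyt : y ∈ φ.target := φ.map_source hqs
  have hyM : y.2 ∈ (extChartAt (𝓡 n) q.2).target := mem_extChartAt_target_iff.1 hyt
  have hy2 : y.2 = extChartAt (𝓡 n) q.2 q.2 := rfl
  have hG : DifferentiableAt ℝ (chartMetric S.metric q) y :=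
    ((S.contDiffOn_chartMetric_metric q).contDiffAt (htarget.mem_nhds hyt)).differentiableAt
      (by simp)
  have hι : ContMDiff (𝓡 n) (spacetimeModel n) ∞ ι := hP.embedding.contMDiff
  obtain ⟨c, hc0, hc, hcv⟩ := exists_curve_mfderiv_eq (J := 𝓡 n) p Z
  have hcd : MDifferentiableAt 𝓘(ℝ, ℝ) (𝓡 n) c 0 := hc.mdifferentiableAt (by simp)
  have hself : ∀ v : TangentSpace (spacetimeModel n) q,
      (mfderiv (spacetimeModel n) 𝓘(ℝ, ℝ × EuclideanSpace ℝ (Fin n)) φ q v :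
        ℝ × EuclideanSpace ℝ (Fin n)) = v := fun v =>
    DFunLike.congr_fun (mfderiv_extChartAt_self (I := spacetimeModel n) (x := q)) v
  -- coordinate expressions
  let e : P → ℝ × EuclideanSpace ℝ (Fin n) := fun p' =>
    mfderiv (spacetimeModel n) 𝓘(ℝ, ℝ × EuclideanSpace ℝ (Fin n)) φ (ι p') (η p')
  let z : ℝ × EuclideanSpace ℝ (Fin n) := mfderiv (spacetimeModel n)
    𝓘(ℝ, ℝ × EuclideanSpace ℝ (Fin n)) φ (ι p) (hypDiff (spacetimeModel n) ι p Z)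
  let θ : EuclideanSpace ℝ (Fin n) := spatialPart (ι p) (η p)
  have he1 : (e p).1 = dt (ι p) (η p) := fst_mfderiv_extChartAt hqs (η p)
  have he2 : (e p).2 = θ := (congrArg Prod.snd (hself (η p))).trans (spatialPart_apply _ _).symm
  have hz1 : z.1 = 1 := (fst_mfderiv_extChartAt hqs _).trans hZt
  have hz2 : z.2 = k • θ := (congrArg Prod.snd (hself (hypDiff (spacetimeModel n) ι p Z))).trans
    ((spatialPart_apply _ _).symm.trans hZk)
  have hed : MDifferentiableAt (𝓡 n) 𝓘(ℝ, ℝ × EuclideanSpace ℝ (Fin n)) e p :=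
    (contMDiffAt_coordinates (hη.smooth p) hqs).mdifferentiableAt (by simp)
  let e' : ℝ × EuclideanSpace ℝ (Fin n) :=
    mfderiv (𝓡 n) 𝓘(ℝ, ℝ × EuclideanSpace ℝ (Fin n)) e p Z
  have hec : HasDerivAt (fun s => e (c s)) e' 0 := hasDerivAt_comp_curve hed hc0 hcd hcv
  have hnear : ∀ᶠ s in 𝓝 (0 : ℝ), ι (c s) ∈ φ.source := by
    refine (hι.continuous.continuousAt.comp hcd.continuousAt).preimage_mem_nhds ?_
    simp only [Function.comp, hc0]
    exact (isOpen_extChartAt_source q).mem_nhds hqs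
  -- the time component
  have hb : HasDerivAt (fun s => dt (ι (c s)) (η (c s)))
      (dirDeriv (fun p => dt (ι p) (η p)) p Z) 0 :=
    hasDerivAt_comp_curve ((contMDiff_dt_normal hη).mdifferentiable (by simp) p) hc0 hcd hcv
  have he'1 : e'.1 = dirDeriv (fun p => dt (ι p) (η p)) p Z := by
    have hec1 : HasDerivAt (fun s => (e (c s)).1) e'.1 0 := hec.fst
    refine hec1.unique (hb.congr_of_eventuallyEq ?_)
    filter_upwards [hnear] with s hs using fst_mfderiv_extChartAt hs _
  -- differentiate the normalisation of the unit normal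
  have hφι : MDifferentiableAt (𝓡 n) 𝓘(ℝ, ℝ × EuclideanSpace ℝ (Fin n)) (fun p' => φ (ι p')) p :=
    ((contMDiffAt_extChartAt (n := ∞)).mdifferentiableAt (by simp)).comp p
      (hι.mdifferentiable (by simp) p)
  have hyc : HasDerivAt (fun s => φ (ι (c s))) z 0 := by
    have h1 := hasDerivAt_comp_curve hφι hc0 hcd hcv
    have h2 : (mfderiv (𝓡 n) 𝓘(ℝ, ℝ × EuclideanSpace ℝ (Fin n)) (fun p' => φ (ι p')) p Z :
        ℝ × EuclideanSpace ℝ (Fin n)) = z :=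
      mfderiv_comp_apply p ((contMDiffAt_extChartAt (n := ∞)).mdifferentiableAt (by simp))
        (hι.mdifferentiable (by simp) p) Z
    rw [← h2]
    exact h1
  have hyc0 : φ (ι (c 0)) = y := by rw [hc0]
  have hGc : HasDerivAt (fun s => chartMetric S.metric q (φ (ι (c s))))
      (fderiv ℝ (chartMetric S.metric q) y z) 0 := by
    have h0 : HasFDerivAt (chartMetric S.metric q)
        (fderiv ℝ (chartMetric S.metric q) y) (φ (ι (c 0))) := by
      rw [hyc0]
      exact hG.hasFDerivAt
    exact h0.comp_hasDerivAt 0 hyc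
  have hunit : (fun s => chartMetric S.metric q (φ (ι (c s))) (e (c s)) (e (c s))) =ᶠ[𝓝 0]
      fun _ => 1 := by
    filter_upwards [hnear] with s hs
    exact (chartMetric_mfderiv S.metric hs (η (c s)) (η (c s))).trans (hη.unit (c s))
  have hE1 := ((hGc.clm_apply hec).clm_apply hec).unique
    ((hasDerivAt_const (0 : ℝ) (1 : ℝ)).congr_of_eventuallyEq hunit)
  simp only [hc0, add_apply] at hE1
  have hsymm := chartMetric_symm (q := q) S.metric_symm
  have hform : ∀ a b, chartMetric S.metric q y a b =
      chartMetric (I := 𝓡 n) S.g.inner q.2 y.2 a.2 b.2 - S.N q.2 ^ 2 * (a.1 * b.1) := by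
    intro a b
    rw [S.chartMetric_metric hyM, hy2, extChartAt_to_inv]
  have hD : ∀ c a b, fderiv ℝ (chartMetric S.metric q) y c a b =
      fderiv ℝ (chartMetric (I := 𝓡 n) S.g.inner q.2) y.2 c.2 a.2 b.2
      - 2 * S.N q.2 * S.lapseDifferential q.2 c.2 * (a.1 * b.1) := by
    intro c a b
    rw [S.fderiv_chartMetric_metric hyM, hy2, extChartAt_to_inv]
    exact congrArg (fun r : ℝ => _ - 2 * S.N q.2 * r * (a.1 * b.1)) (fderiv_lapse_chart S q.2 c.2)
  -- Both spatial parts are multiples of `θ`, so this is the only derivative of `g` that occurs; it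
  -- cancels at the end.
  set D : ℝ := fderiv ℝ (chartMetric (I := 𝓡 n) S.g.inner q.2) y.2 θ θ θ with hDdef
  set β := dt (ι p) (η p) with hβ
  set d : ℝ := S.lapseDifferential q.2 θ with hd
  have hDe : fderiv ℝ (chartMetric S.metric q) y (e p) z z = k ^ 2 * D - 2 * S.N q.2 * d := by
    rw [hD, he2, hz2, hz1]
    simp only [map_smul, smul_apply, smul_eq_mul, ← hDdef, ← hd]
    ring
  have hdk : S.lapseDifferential q.2 (k • θ) = k * d := map_smul (S.lapseDifferential q.2) k θ
  have hDz : fderiv ℝ (chartMetric S.metric q) y z (e p) (e p) =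
      k * D - 2 * S.N q.2 * (k * d) * β ^ 2 := by
    rw [hD, he2, hz2, he1, hdk]
    simp only [map_smul, smul_apply, smul_eq_mul, ← hDdef]
    ring
  have hsec : secondFundamentalForm S.metric ι η p Z Z = chartMetric S.metric q y e' z
      + christoffelInChart S.metric q y z (e p) z := rfl
  rw [hsec, christoffelInChart_eq hG, fderiv_chartMetric_symm S.metric_symm hG z z (e p), hDe]
  -- The vector `z - k η` is purely temporal with time component `1 - k β`.
  have hGe : chartMetric S.metric q y e' z = k * chartMetric S.metric q y e' (e p)
      - S.N q.2 ^ 2 * (e'.1 * (1 - k * β)) := by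
    rw [hform, hform, hz1, hz2, he1, he2, map_smul, smul_eq_mul]
    ring
  change _ + chartMetric S.metric q y e' (e p) + chartMetric S.metric q y (e p) e' = 0 at hE1
  rw [hsymm y (e p) e', hDz] at hE1
  rw [hGe, he'1]
  -- The relation `hE1` is `2 G(∇_Z η, η) = 0`, so it removes the component of `z` along `η`.
  linear_combination (k / 2) * hE1

end StaticSpacetime

/-! ### Mean curvature of a photon surface and the evolution identity. -/

namespace StaticSpacetime

variable {n : ℕ} {M : Type*} [TopologicalSpace M]
  [ChartedSpace (EuclideanSpace ℝ (Fin n)) M] [IsManifold (𝓡 n) ∞ M]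
  {P : Type*} [TopologicalSpace P] [ChartedSpace (EuclideanSpace ℝ (Fin n)) P]
  [IsManifold (𝓡 n) ∞ P]
  {S : StaticSpacetime n M} {ι : P → ℝ × M}
  {η : ∀ p, TangentSpace (spacetimeModel n) (ι p)}

/-- The orthogonal complement of the vertical vector field in a timelike hypersurface is
spacelike. -/
lemma metric_pos_of_orthogonal_vertical (hP : IsTimelikeHypersurface (n := n) S.metric ι)
    {p : P} {Z : TangentSpace (𝓡 n) p} (hZ : S.IsVertical ι p Z)
    (hZZ : S.metric (ι p) (hypDiff (spacetimeModel n) ι p Z)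
      (hypDiff (spacetimeModel n) ι p Z) < 0)
    (v : TangentSpace (𝓡 n) p)
    (hv : S.metric (ι p) (hypDiff (spacetimeModel n) ι p Z)
      (hypDiff (spacetimeModel n) ι p v) = 0) (hv0 : v ≠ 0) :
    0 < S.metric (ι p) (hypDiff (spacetimeModel n) ι p v)
      (hypDiff (spacetimeModel n) ι p v) := by
  -- Subtracting `r Z` leaves a slice vector, orthogonal to `Z`; hence `r G(Z, Z) = 0` and `v` is
  -- itself tangent to the slice, where the metric is `g`.
  set r := dt (ι p) (hypDiff (spacetimeModel n) ι p v) with hr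
  have h1 : TangentToSlice ι p (v - r • Z) := by
    rw [TangentToSlice, map_sub, map_smul, map_sub, map_smul, hZ.time, ← hr]
    simp
  have h2 := hZ.orthogonal _ h1
  rw [map_sub, map_smul, map_sub, map_smul, hv, zero_sub, smul_eq_mul, neg_eq_zero] at h2
  have hr0 : dt (ι p) (hypDiff (spacetimeModel n) ι p v) = 0 :=
    (mul_eq_zero.1 h2).resolve_right hZZ.ne
  rw [metric_apply, hr0, mul_zero, mul_zero, sub_zero]
  refine S.g.pos _ _ fun h0 => hv0 ?_
  refine IsImmersionAt.mfderiv_injective (hP.embedding.isImmersion.isImmersionAt p) ?_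
  rw [map_zero]
  exact ext_dt_spatialPart (hr0.trans (map_zero _).symm) (h0.trans (map_zero _).symm)

/-- The mean curvature of a photon surface in terms of the time component of its unit normal. -/
lemma meanCurvature_photonSurface (hP : IsPhotonSurface (n := n) S.metric ι)
    (hη : IsUnitNormal (n := n) S.metric ι η) {p : P} {Z : TangentSpace (𝓡 n) p}
    (hZ : S.IsVertical ι p Z) :
    meanCurvature (n := n) S.metric ι η p = n * (dirDeriv (fun p => dt (ι p) (η p)) p Z +
      (1 + S.N (ι p).2 ^ 2 * dt (ι p) (η p) ^ 2 /
        (1 + S.N (ι p).2 ^ 2 * dt (ι p) (η p) ^ 2)) *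
      S.lapseDifferential (ι p).2 (spatialPart (ι p) (η p)) / S.N (ι p).2) := by
  have hPt := hP.toIsTimelikeHypersurface
  have hN := S.N_pos (ι p).2
  have hsp := spatialPart_vertical hPt hη hZ
  have hA := inner_spatialPart_normal hη p
  have hII := secondFundamentalForm_vertical hPt hη hZ.time hsp
  have hZZ : S.metric (ι p) (hypDiff (spacetimeModel n) ι p Z)
      (hypDiff (spacetimeModel n) ι p Z) =
      -(S.N (ι p).2 ^ 2 / (1 + S.N (ι p).2 ^ 2 * dt (ι p) (η p) ^ 2)) := by
    rw [metric_apply, hsp, hZ.time, map_smul, map_smul, smul_apply, hA]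
    have : 1 + S.N (ι p).2 ^ 2 * dt (ι p) (η p) ^ 2 ≠ 0 := by positivity
    simp only [smul_eq_mul]
    field_simp
    ring
  have hneg : S.metric (ι p) (hypDiff (spacetimeModel n) ι p Z)
      (hypDiff (spacetimeModel n) ι p Z) < 0 := by
    rw [hZZ, neg_lt_zero]
    positivity
  rw [meanCurvature_eq_of_null S.metric_symm ι η p
    (((S.contDiffOn_chartMetric_metric (ι p)).contDiffAt
      (extChartAt_target_mem_nhds (ι p))).differentiableAt (by simp))
    (fun v hv => hP.secondFundamentalForm_null S.metric_symm S.metric_nondegenerate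
      S.contDiffOn_chartMetric_metric hη p v hv) hneg
    (metric_pos_of_orthogonal_vertical hPt hZ hneg), hII, hZZ]
  have : 1 + S.N (ι p).2 ^ 2 * dt (ι p) (η p) ^ 2 ≠ 0 := by positivity
  congr 1
  field_simp
  ring

lemma contMDiff_lapseDifferential_normal (hη : IsUnitNormal (n := n) S.metric ι η) :
    ContMDiff (𝓡 n) 𝓘(ℝ, ℝ) ∞
      (fun p => S.lapseDifferential (ι p).2 (spatialPart (ι p) (η p))) := by
  have h1 : ContMDiff (spacetimeModel n) 𝓘(ℝ, ℝ) ∞ (fun x : ℝ × M => S.N x.2) :=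
    S.smooth_N.comp contMDiff_snd
  have h2 := (h1.contMDiff_tangentMap (m := ∞) (by simp)).comp hη.smooth
  refine ((contMDiff_snd_tangentBundle_modelSpace ℝ 𝓘(ℝ, ℝ)).comp h2).congr fun p => ?_
  exact (mfderiv_comp_apply (ι p) (g := S.N) (f := (Prod.snd : ℝ × M → M))
    (S.smooth_N.mdifferentiable (by simp) _) mdifferentiableAt_snd (η p)).symm

/-- This function of the pair `(N, dt(η))` is the quotient `u'/ν(N)`, whose smoothness on `P` thus
needs no regularity of `ν`. -/
lemma contDiff_div_sqrt :
    ContDiff ℝ ∞ (fun x : ℝ × ℝ => x.1 ^ 2 * x.2 / √(1 + x.1 ^ 2 * x.2 ^ 2)) := by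
  refine ContDiff.div (by fun_prop) (ContDiff.sqrt (by fun_prop) fun x => ?_) fun x => ?_
  · positivity
  · positivity

lemma hasDerivAt_div_sqrt {f g : ℝ → ℝ} {f' g' t : ℝ} (hf : HasDerivAt f f' t)
    (hg : HasDerivAt g g' t) :
    HasDerivAt (fun s => f s ^ 2 * g s / √(1 + f s ^ 2 * g s ^ 2))
      ((2 * f t * f' * g t + f t ^ 2 * g') / √(1 + f t ^ 2 * g t ^ 2)
        - f t ^ 2 * g t * (f t * f' * g t ^ 2 + f t ^ 2 * g t * g') /
          √(1 + f t ^ 2 * g t ^ 2) ^ 3) t := by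
  have hA : 0 < 1 + f t ^ 2 * g t ^ 2 := by positivity
  have h1 := ((hf.pow 2).mul (hg.pow 2)).const_add 1
  have h2 := ((hf.pow 2).mul hg).div (h1.sqrt hA.ne') (Real.sqrt_pos.2 hA).ne'
  refine h2.congr_deriv ?_
  have h3 := (Real.sqrt_pos.2 hA).ne'
  simp only [Pi.mul_apply, Pi.pow_apply]
  field_simp
  ring

/-- Here `B = dt(η)`, `A = √(1 + N²B²)`, `D` is `dN` of the spatial part of `η`, `b' = Z(B)` and `m
= n`. The recurring `N ^ 2 * B / A ^ 2 * D` is `u'`, which is also `Z(N)`. -/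
lemma evolution_identity {N A B D b' m : ℝ} (hA : A ≠ 0) (hN : N ≠ 0) (hm : m ≠ 0)
    (h : A ^ 2 = 1 + N ^ 2 * B ^ 2) :
    N * (m * (b' + (1 + N ^ 2 * B ^ 2 / A ^ 2) * D / N)) / m * A⁻¹ ^ 3 =
      A⁻¹ ^ 2 * (A⁻¹ * D) + 1 / N * ((2 * N * (N ^ 2 * B / A ^ 2 * D) * B + N ^ 2 * b') / A
        - N ^ 2 * B * (N * (N ^ 2 * B / A ^ 2 * D) * B ^ 2 + N ^ 2 * B * b') / A ^ 3)
        - (N ^ 2 * B / A ^ 2 * D) ^ 2 / (N ^ 2 * (A⁻¹ * D)) := by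
  field_simp
  grind

/-- An accumulating family of zeros of a differentiable function is a critical zero. -/
lemma eq_zero_and_deriv_eq_zero_of_accPt {f : ℝ → ℝ} {t₀ : ℝ} (hf : DifferentiableAt ℝ f t₀)
    {s : Set ℝ} (hs : AccPt t₀ (𝓟 s)) (h : ∀ t ∈ s, f t = 0) : f t₀ = 0 ∧ deriv f t₀ = 0 := by
  have hfreq : ∃ᶠ t in 𝓝[≠] t₀, f t = 0 := (accPt_iff_frequently_nhdsNE.1 hs).mono h
  have h0 : f t₀ = 0 := by
    have hc : Tendsto f (𝓝[≠] t₀) (𝓝 (f t₀)) := hf.continuousAt.tendsto.mono_left nhdsWithin_le_nhds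
    by_contra hne
    exact hfreq (hc.eventually_ne hne)
  refine ⟨h0, ?_⟩
  -- The difference quotients from `t₀` to the zeros are all zero, so they cannot tend to a nonzero
  -- limit.
  by_contra hne
  have hd := hasDerivAt_iff_tendsto_slope.1 hf.hasDerivAt
  refine hfreq ((hd.eventually_ne hne).mono fun t ht h' => ht ?_)
  simp [slope_def_field, h', h0]

end StaticSpacetime

/-! ### The main theorem. -/

open StaticSpacetime in
theorem mainTheorem10 {n : ℕ} {M : Type*} [TopologicalSpace M]
    [ChartedSpace (EuclideanSpace ℝ (Fin n)) M] [IsManifold (𝓡 n) ∞ M]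
    {P : Type*} [TopologicalSpace P] [ChartedSpace (EuclideanSpace ℝ (Fin n)) P]
    [IsManifold (𝓡 n) ∞ P]
    (S : StaticSpacetime n M) (ι : P → ℝ × M)
    (hP : IsPhotonSurface (n := n) S.metric ι)
    (hequi : S.IsEquipotential ι) (hnondeg : S.IsNondegenerate ι)
    (η : ∀ p, TangentSpace (spacetimeModel n) (ι p)) (hη : IsUnitNormal (n := n) S.metric ι η)
    (ν : ∀ p, TangentSpace (𝓡 n) (ι p).2) (hν : ∀ p, S.IsSliceNormal ι η p (ν p))
    (Z : ∀ p, TangentSpace (𝓡 n) p) (hZ : ∀ p, S.IsVertical ι p (Z p)) :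
    let u : ℝ → ℝ := S.lapseAlong ι
    let u' : ℝ → ℝ := deriv u
    let time : P → ℝ := fun p => (ι p).1
    let νN : P → ℝ := S.normalDerivLapse ι ν
    let Hm : P → ℝ := meanCurvature (n := n) S.metric ι η
    let w : P → ℝ := fun p => u' (time p) ^ 2 / (u (time p) ^ 2 * νN p ^ 2)
    -- all quantities in the evolution equation are well defined
    (IsOpen (StaticSpacetime.times ι) ∧ ContDiffOn ℝ ∞ u (StaticSpacetime.times ι) ∧
      (∀ p, 0 < u (time p) ∧ νN p ≠ 0 ∧ w p < 1) ∧
      ContMDiff (𝓡 n) 𝓘(ℝ, ℝ) ∞ (fun p => u' (time p) / νN p)) ∧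
    -- the evolution equation
    (∀ p, u (time p) * Hm p / n * √(1 - w p) ^ 3 =
      (1 - w p) * νN p
        + 1 / u (time p) * StaticSpacetime.dirDeriv (fun q => u' (time q) / νN q) p (Z p)
        - u' (time p) ^ 2 / (u (time p) ^ 2 * νN p)) ∧
    -- accumulating zeros of the derivative
    (∀ (t : ℕ → ℝ) (t₀ : ℝ), (∀ i, t i ∈ StaticSpacetime.times ι) →
      t₀ ∈ StaticSpacetime.times ι → AccPt t₀ (𝓟 (range t)) → (∀ i, u' (t i) = 0) →
      ∀ p ∈ StaticSpacetime.timeSlice ι t₀, u t₀ * Hm p = n * νN p) ∧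
    -- photon spheres
    (S.IsPhotonSphere ι → ∀ p, S.N (ι p).2 * Hm p = n * νN p) := by
  intro u u' time νN Hm w
  have hPt := hP.toIsTimelikeHypersurface
  have hι : ContMDiff (𝓡 n) (spacetimeModel n) ∞ ι := hPt.embedding.contMDiff
  have hu : ∀ p, u (time p) = S.N (ι p).2 := hequi.lapseAlong_time
  have hupos : ∀ p, 0 < u (time p) := fun p => by rw [hu]; exact S.N_pos _
  set b : P → ℝ := fun p => dt (ι p) (η p) with hb
  set d : P → ℝ := fun p => S.lapseDifferential (ι p).2 (spatialPart (ι p) (η p)) with hd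
  set a : P → ℝ := fun p => √(1 + S.N (ι p).2 ^ 2 * b p ^ 2) with ha
  have hApos : ∀ p, 0 < 1 + S.N (ι p).2 ^ 2 * b p ^ 2 := fun p => by positivity
  have hapos : ∀ p, 0 < a p := fun p => Real.sqrt_pos.2 (hApos p)
  have ha2 : ∀ p, a p ^ 2 = 1 + S.N (ι p).2 ^ 2 * b p ^ 2 := fun p => Real.sq_sqrt (hApos p).le
  have hd0 : ∀ p, d p ≠ 0 := fun p => mfderiv_lapse_normal_ne_zero hPt hequi hnondeg hη p
  have hνN : ∀ p, νN p = (a p)⁻¹ * d p := normalDerivLapse_eq hPt hη hν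
  have hu' : ∀ p, u' (time p) = S.N (ι p).2 ^ 2 * b p / a p ^ 2 * d p := fun p => by
    rw [ha2]
    exact deriv_lapseAlong_eq hPt hequi hη (hZ p)
  have hνN0 : ∀ p, νN p ≠ 0 := fun p => by
    rw [hνN]
    exact mul_ne_zero (inv_ne_zero (hapos p).ne') (hd0 p)
  have hw : ∀ p, 1 - w p = ((a p)⁻¹) ^ 2 := fun p => by
    have h1 := (hapos p).ne'
    have h2 := hd0 p
    have h3 := (S.N_pos (ι p).2).ne'
    simp only [w]
    rw [hu', hu, hνN]
    field_simp
    rw [ha2]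
    ring
  have hquot : (fun p => u' (time p) / νN p) =
      fun p => S.N (ι p).2 ^ 2 * b p / √(1 + S.N (ι p).2 ^ 2 * b p ^ 2) := by
    funext p
    have h1 := (hapos p).ne'
    have h2 := hd0 p
    change _ = S.N (ι p).2 ^ 2 * b p / a p
    rw [hu', hνN]
    field_simp
  have hsmooth : ContMDiff (𝓡 n) 𝓘(ℝ, ℝ) ∞ (fun p => u' (time p) / νN p) := by
    rw [hquot]
    exact contDiff_div_sqrt.comp_contMDiff
      ((contMDiff_lapse (S := S) hι).prodMk_space (contMDiff_dt_normal hη))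
  have hdir : ∀ p, dirDeriv (fun q => u' (time q) / νN q) p (Z p) =
      (2 * S.N (ι p).2 * u' (time p) * b p + S.N (ι p).2 ^ 2 * dirDeriv b p (Z p)) / a p
        - S.N (ι p).2 ^ 2 * b p * (S.N (ι p).2 * u' (time p) * b p ^ 2
          + S.N (ι p).2 ^ 2 * b p * dirDeriv b p (Z p)) / a p ^ 3 := by
    intro p
    obtain ⟨c, hc0, hc, hcv⟩ := exists_curve_mfderiv_eq (J := 𝓡 n) p (Z p)
    have hcd : MDifferentiableAt 𝓘(ℝ, ℝ) (𝓡 n) c 0 := hc.mdifferentiableAt (by simp)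
    have h1 : HasDerivAt (fun s => u' (time (c s)) / νN (c s))
        (dirDeriv (fun q => u' (time q) / νN q) p (Z p)) 0 :=
      hasDerivAt_comp_curve (hsmooth.mdifferentiable (by simp) p) hc0 hcd hcv
    have h2 : HasDerivAt (fun s => b (c s)) (dirDeriv b p (Z p)) 0 :=
      hasDerivAt_comp_curve ((contMDiff_dt_normal hη).mdifferentiable (by simp) p) hc0 hcd hcv
    have h3 : HasDerivAt (fun s => S.N (ι (c s)).2) (u' (time p)) 0 := by
      have h4 := hasDerivAt_comp_curve ((contMDiff_lapse (S := S) hι).mdifferentiable (by simp) p)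
        hc0 hcd hcv
      have h5 := (mfderiv_lapse (S := S) (hι.mdifferentiable (by simp) p) (Z p)).trans
        (mfderiv_lapse_eq_deriv hPt hequi p (Z p))
      rw [(hZ p).time, mul_one] at h5
      exact h4.congr_deriv h5
    have h6 := hasDerivAt_div_sqrt h3 h2
    have h7 := h1.unique (h6.congr_of_eventuallyEq
      (Eventually.of_forall fun s => congrFun hquot (c s)))
    rw [hc0] at h7
    exact h7
  have hHm : ∀ p, Hm p = n * (dirDeriv b p (Z p) +
      (1 + S.N (ι p).2 ^ 2 * b p ^ 2 / a p ^ 2) * d p / S.N (ι p).2) := fun p => by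
    rw [ha2]
    exact meanCurvature_photonSurface hP hη (hZ p)
  -- In dimension zero the tangent spaces of `P` are trivial and `dt` could not be nonzero on them;
  -- this justifies dividing by `n`.
  have hn : P → (n : ℝ) ≠ 0 := by
    rintro p hn
    obtain rfl : n = 0 := by exact_mod_cast hn
    obtain ⟨v, hv⟩ := exists_dt_ne_zero hPt p
    have h0 : ∀ v : EuclideanSpace ℝ (Fin 0), v = 0 := fun v => Subsingleton.elim _ _
    have hv0 : v = 0 := h0 v
    apply hv
    rw [hv0, map_zero, map_zero]
  have hevol : ∀ p, u (time p) * Hm p / n * √(1 - w p) ^ 3 =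
      (1 - w p) * νN p
        + 1 / u (time p) * StaticSpacetime.dirDeriv (fun q => u' (time q) / νN q) p (Z p)
        - u' (time p) ^ 2 / (u (time p) ^ 2 * νN p) := by
    intro p
    have h1 := (hapos p).ne'
    have h2 := hd0 p
    have h3 := (S.N_pos (ι p).2).ne'
    have h4 := hn p
    rw [hdir, hw, Real.sqrt_sq (inv_nonneg.2 (hapos p).le), hHm, hu, hu', hνN]
    have h5 := ha2 p
    exact evolution_identity h1 h3 h4 h5
  have hcrit : ∀ p, u' (time p) = 0 →
      dirDeriv (fun q => u' (time q) / νN q) p (Z p) = 0 → u (time p) * Hm p = n * νN p := by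
    intro p h1 h2
    have h3 := hevol p
    have h4 : w p = 0 := by simp [w, h1]
    rw [h2, h1, h4] at h3
    simp only [sub_zero, Real.sqrt_one, one_pow, mul_one, one_mul, mul_zero, add_zero, ne_eq,
      OfNat.ofNat_ne_zero, not_false_eq_true, zero_pow, zero_div] at h3
    rw [div_eq_iff (hn p)] at h3
    rw [h3, mul_comm]
  have husmooth : ∀ t ∈ times ι, ContDiffAt ℝ ∞ u t := fun t ht =>
    contDiffAt_lapseAlong hPt hequi ht
  refine ⟨⟨isOpen_times hPt, fun t ht => (husmooth t ht).contDiffWithinAt,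
    fun p => ⟨hupos p, hνN0 p, ?_⟩, hsmooth⟩, hevol, ?_, ?_⟩
  · have h1 := hw p
    have h2 := hapos p
    have h3 : 0 < ((a p)⁻¹) ^ 2 := by positivity
    linarith
  · rintro t t₀ - ht₀ hacc hzero p rfl
    have hu'd : DifferentiableAt ℝ u' (time p) :=
      (((husmooth _ ht₀).fderiv_right (m := 1) (one_add_one_eq_two.le.trans ENat.LEInfty.out)).differentiableAt
        one_ne_zero).clm_apply (differentiableAt_const 1)
    obtain ⟨h0, h1⟩ := eq_zero_and_deriv_eq_zero_of_accPt hu'd hacc (by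
      rintro _ ⟨i, rfl⟩
      exact hzero i)
    refine hcrit p h0 ?_
    obtain ⟨c, rfl, hc, hcv⟩ := exists_curve_mfderiv_eq (J := 𝓡 n) p (Z p)
    have hcd : MDifferentiableAt 𝓘(ℝ, ℝ) (𝓡 n) c 0 := hc.mdifferentiableAt (by simp)
    have hquot' := hasDerivAt_comp_curve (hsmooth.mdifferentiable (by simp) _) rfl hcd hcv
    have htime : HasDerivAt (fun s => time (c s)) 1 0 := by
      have hfst : ContMDiff (𝓡 n) 𝓘(ℝ, ℝ) ∞ time := contMDiff_fst.comp hι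
      refine (hasDerivAt_comp_curve (hfst.mdifferentiable (by simp) _) rfl hcd hcv).congr_deriv ?_
      exact (mfderiv_time (hι.mdifferentiable (by simp) _) _).trans (hZ (c 0)).time
    have hcomp := hu'd.hasDerivAt.comp (0 : ℝ) htime
    have hlapse := (hasDerivAt_comp_curve
      ((contMDiff_lapse (S := S) hι).mdifferentiable (by simp) _) rfl hcd hcv).differentiableAt
    have hbd := (hasDerivAt_comp_curve
      ((contMDiff_dt_normal hη).mdifferentiable (by simp) _) rfl hcd hcv).differentiableAt
    have hdd := (hasDerivAt_comp_curve
      ((contMDiff_lapseDifferential_normal hη).mdifferentiable (by simp) _) rfl hcd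
        hcv).differentiableAt
    -- No smoothness of `ν` is given, so differentiability of `ν(N)` is read off from its expression
    -- through `η`. The quotient rule then gives zero because `u'` and `u''` vanish at this time.
    have hνNd : DifferentiableAt ℝ (fun s => νN (c s)) 0 := by
      simp only [hνN]
      exact (((((hlapse.pow 2).mul (hbd.pow 2)).const_add 1).sqrt (hApos _).ne').inv
        (hapos _).ne').mul hdd
    have hdiv := hcomp.div hνNd.hasDerivAt (hνN0 _)
    refine (hquot'.unique hdiv).trans ?_
    simp only [Function.comp_apply, h0, h1]
    simp
  · intro hS p
    rw [← hu]
    have h0 : ∀ q, u' (time q) = 0 := by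
      intro q
      -- Openness of `times ι` matters: outside it `u` has the default value zero, and constancy is
      -- needed on a neighbourhood.
      have : u =ᶠ[𝓝 (time q)] fun _ => S.N (ι q).2 := by
        filter_upwards [(isOpen_times hPt).mem_nhds ⟨q, rfl⟩] with t ht
        obtain ⟨q', rfl⟩ := ht
        exact (hu q').trans (hS.lapse_const q' q)
      exact this.deriv_eq.trans (deriv_const _ _)
    refine hcrit p (h0 p) ?_
    have h1 : (fun q => u' (time q) / νN q) = fun _ => 0 := by
      funext q
      rw [h0, zero_div]
    rw [h1]
    exact DFunLike.congr_fun mfderiv_const (Z p)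

end
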